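/- Let $k\ge 0$. There exist a $*$-probability space $(\mathcal A,\varphi)$ (a unital $*$-algebra over $\mathbb C$ with a state $\varphi$, i.e. a linear functional with $\varphi(1)=1$ and $\varphi(a^*a)\ge 0$ for all $a$) and elements $N_1,\dots,N_k,\tilde N_1,\dots,\tilde N_k\in\mathcal A$, such that: (a) $N_1,\dots,N_k$ are independent standard complex Gaussian variables of $(\mathcal A,\varphi)$, and so are $\tilde N_1,\dots,\tilde N_k$ (nothing is asserted about the relation between the two collections). Here $a\in\mathcal A$ is a standard complex Gaussian variable if $aa^*=a^*a$ and $\varphi(a^p(a^*)^q)=\mathbb E[Z^p\bar Z^q]$ for all integers $p,q\ge 0$, where $Z=X+\iota Y$ with $X,Y$ independent real centred Gaussian variables of variance $1/2$. Elements $a_1,\dots,a_k$ are independent if the unital $*$-subalgebras $\mathcal A_1,\dots,\mathcal A_k$ generated by each of them commute with one another and $\varphi(x_1\cdots x_k)=\prod_{j}\varphi(x_j)$ whenever $x_j\in\mathcal A_j$ for all $j$. (b) Let $\{\tau^{(j)}_i: 1\le j\le k,\ i\in\mathbb Z\}$ be any independent (real or complex) random variables on a probability space with $\mathbb E\tau^{(j)}_i=0$,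 $\mathbb E|\tau^{(j)}_i|^2=1$ and $\sup_{i,j}\mathbb E|\tau^{(j)}_i|^p<\infty$ for every $p\in\mathbb N$. Let $T_n^{(j)}=((\tau^{(j)}_{i'-i}))_{0\le i,i'\le n-1}$ be the corresponding independent non-symmetric Toeplitz matrices. Then $\{n^{-1/2}T_n^{(j)}\}_{1\le j\le k}$, as elements of the random $n\times n$ matrices with the functional $\varphi_n=n^{-1}\mathbb E\,\mathrm{Tr}$, converge jointly in $*$-distribution to $\{(N_j+\tilde N_j)/\sqrt2\}_{1\le j\le k}$. That is, for every monomial $Q$ in $k$ non-commuting variables and their adjoints, the trace of $Q(n^{-1/2}T_n^{(1)},\dots,n^{-1/2}T_n^{(k)})$ is integrable for every $n$, and $$\lim_{n\to\infty}\varphi_n\bigl(Q(n^{-1/2}T_n^{(1)},\dots,n^{-1/2}T_n^{(k)})\bigr)=\varphi\Bigl(Q\Bigl(\tfrac{N_1+\tilde N_1}{\sqrt2},\dots,\tfrac{N_k+\tilde N_k}{\sqrt2}\Bigr)\Bigr).$$ -/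

import Mathlib

universe u

open MeasureTheory ProbabilityTheory Filter Topology

noncomputable section

/-! ### Non-commutative `*`-probability spaces -/

/-- `φ` is a state on the unital `*`-algebra `A`, that is, `(A, φ)` is a `*`-probability space:
`φ` is linear, unital and positive. -/
structure IsState {A : Type*} [Ring A] [StarRing A] [Algebra ℂ A] (φ : A →ₗ[ℂ] ℂ) : Prop where
  map_one : φ 1 = 1
  nonneg_re : ∀ a : A, 0 ≤ (φ (star a * a)).re
  im_eq_zero : ∀ a : A, (φ (star a * a)).im = 0

/-- The monomial in the variables `a i` and their adjoints which is spelled by the word `w`: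
the letter `(i, false)` stands for `a i` and the letter `(i, true)` for `star (a i)`. -/
def starWord {ι A : Type*} [Monoid A] [Star A] (a : ι → A) (w : List (ι × Bool)) : A :=
  (w.map fun l => if l.2 then star (a l.1) else a l.1).prod

/-- Joint convergence in `*`-distribution of the families `b n` in `(B n, φn n)` to the family
`a` in `(A, φ)`: convergence of all joint `*`-moments. -/
def TendstoInStarDistribution {ι : Type*} {B : ℕ → Type*} [∀ n, Monoid (B n)] [∀ n, Star (B n)]
    {A : Type*} [Monoid A] [Star A]
    (φn : ∀ n, B n → ℂ) (b : ∀ n, ι → B n) (φ : A → ℂ) (a : ι → A) : Prop :=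
  ∀ w : List (ι × Bool),
    Tendsto (fun n => φn n (starWord (b n) w)) atTop (𝓝 (φ (starWord a w)))

/-- The standard complex Gaussian law: the law of `x + i y` with `x`, `y` independent real
centred Gaussian of variance `1 / 2`. -/
def stdComplexGaussian : Measure ℂ :=
  ((gaussianReal 0 (1 / 2)).prod (gaussianReal 0 (1 / 2))).map
    fun p : ℝ × ℝ => (p.1 : ℂ) + (p.2 : ℂ) * Complex.I

/-- `a` is a standard complex Gaussian variable of `(A, φ)`: it commutes with its adjoint and its
`*`-moments are those of the standard complex Gaussian law. -/
structure IsStdComplexGaussianVar {A : Type*} [Ring A] [StarRing A] [Algebra ℂ A]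
    (φ : A →ₗ[ℂ] ℂ) (a : A) : Prop where
  normal : Commute (star a) a
  moment : ∀ p q : ℕ,
    φ (a ^ p * star a ^ q) = ∫ z, z ^ p * (starRingEnd ℂ z) ^ q ∂stdComplexGaussian

/-- Independence (in the classical, commuting sense) of the variables `a 0, …, a (k - 1)` of
`(A, φ)`: the unital `*`-subalgebras that they generate commute with each other, and `φ`
factorizes over them. -/
structure IsIndepFamily {A : Type*} [Ring A] [StarRing A] [Algebra ℂ A] [StarModule ℂ A]
    (φ : A →ₗ[ℂ] ℂ) {k : ℕ} (a : Fin k → A) : Prop where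
  commute : ∀ i j, i ≠ j → ∀ x ∈ StarAlgebra.adjoin ℂ {a i}, ∀ y ∈ StarAlgebra.adjoin ℂ {a j},
    Commute x y
  factor : ∀ x : Fin k → A, (∀ i, x i ∈ StarAlgebra.adjoin ℂ {a i}) →
    φ (List.ofFn x).prod = ∏ i, φ (x i)

/-! ### Random Toeplitz matrices -/

/-- The random variables `X i` are independent, with zero mean, unit variance and, for every
order, uniformly bounded moments. Real variables are the ones with values in `ℝ ⊆ ℂ`. -/
structure IsStandardizedInput {Ω ι : Type*} [MeasurableSpace Ω] (P : Measure Ω)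
    (X : ι → Ω → ℂ) : Prop where
  measurable : ∀ i, Measurable (X i)
  indep : iIndepFun X P
  mean_zero : ∀ i, ∫ ω, X i ω ∂P = 0
  unit_variance : ∀ i, ∫ ω, ‖X i ω‖ ^ 2 ∂P = 1
  bounded_moments : ∀ p : ℕ, ∃ C : ℝ, ∀ i,
    Integrable (fun ω => ‖X i ω‖ ^ p) P ∧ ∫ ω, ‖X i ω‖ ^ p ∂P ≤ C

/-- The `n × n` random Toeplitz matrix `(τ (j - i))`, `0 ≤ i, j ≤ n - 1`. -/
def randomToeplitz {Ω : Type*} (τ : ℤ → Ω → ℂ) (n : ℕ) : Ω → Matrix (Fin n) (Fin n) ℂ :=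
  fun ω => Matrix.of fun i j => τ (((j : ℕ) : ℤ) - ((i : ℕ) : ℤ)) ω

/-- The scaled matrix `n^{-1/2} T_n`. -/
def scaledToeplitz {Ω : Type*} (τ : ℤ → Ω → ℂ) (n : ℕ) : Ω → Matrix (Fin n) (Fin n) ℂ :=
  ((Real.sqrt n : ℝ) : ℂ)⁻¹ • randomToeplitz τ n

/-- The functional `n⁻¹ E Tr` on `n × n` random matrices. -/
def expectedTrace {Ω : Type*} [MeasurableSpace Ω] (P : Measure Ω) (n : ℕ)
    (X : Ω → Matrix (Fin n) (Fin n) ℂ) : ℂ :=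
  (n : ℂ)⁻¹ * ∫ ω, (X ω).trace ∂P

end

/-! The proof combines universality of the limiting moments with an exact decomposition in the
Gaussian case.

Universality. The trace of a word of length `m` is a sum over closed paths in `{0, …, n-1}`, each
contributing the mean of a product of entries. A path that meets some variable only once contributes
zero. The surviving paths have at most `m/2` free increments besides the starting point, so there
are `O(n^(1+m/2))` of them, which the normalization cancels. If the variables do not occur exactly
in pairs of one letter and one adjoint, either there are fewer distinct variables or the closing
condition is a nontrivial equation on the increments; both lose a factor of at least `√n`
(`card_not_paired_le`). Each opposite pair contributes `E|τ|² = 1`, so `E τ²` plays no role and real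
and complex entries behave alike. What remains is a count of lattice points in polytopes
(`tendsto_card_pairedPaths`), and the limit `toeplitzMoment` does not depend on the law of the
entries (`tendsto_expectedTrace_toeplitz`).

Gaussian model. By universality, the limit may be computed with complex Gaussian entries. There
`n^{-1/2} T_n` equals `(C + C')/√2`, with `C` circulant and `C'` skew-circulant
(`circulantPart_add_circulantPart_half`). For each twist, a fixed unitary diagonalizes the matrices
of all `k` families, and each tuple of joint eigenvalues consists of independent standard complex
Gaussians. Hence for every `n ≥ 1` each of the two collections already has the required moments
(`expectedTrace_circulantCalculus`).

Limit space. The mixed moments of `C` and `C'` need not be computed. Both lie in the algebra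
generated by Toeplitz matrices with bounded weights and shifted indices, whose normalized traces are
bounded by the same path count (`exists_bound_expectedTrace_weightedToeplitz`). An ultrafilter limit
of these traces is a state, and it agrees with the ordinary limit wherever that exists;
`limitState_starWord` then identifies the moments of `(C + C')/√2`. -/

noncomputable section

/-! ### Paths and their keys -/

/-- The sign of a letter: `-1` for adjoints, `1` otherwise. -/
def letterSign (b : Bool) : ℤ := if b then -1 else 1

theorem letterSign_mul_self (b : Bool) : letterSign b * letterSign b = 1 := by
  cases b <;> simp [letterSign]

theorem letterSign_ne_zero (b : Bool) : letterSign b ≠ 0 := by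
  cases b <;> simp [letterSign]

/-- The increment of the path `p` at time `r`. -/
def pathStep {m n : ℕ} (p : Fin (m + 1) → Fin n) (r : Fin m) : ℤ :=
  ((p r.succ : ℕ) : ℤ) - ((p r.castSucc : ℕ) : ℤ)

/-- The index of the random variable that the path `p` meets at time `r`. -/
def pathKey {ι : Type*} {m n : ℕ} (J : Fin m → ι) (e : Fin m → Bool) (c : Fin m → ℤ)
    (p : Fin (m + 1) → Fin n) (r : Fin m) : ι × ℤ :=
  (J r, c r + letterSign (e r) * pathStep p r)

/-- Every value of `κ` is taken at least twice. -/
def IsMatched {m : ℕ} {K : Type*} (κ : Fin m → K) : Prop := ∀ r, ∃ s, s ≠ r ∧ κ s = κ r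

theorem path_ext {m n : ℕ} {p q : Fin (m + 1) → Fin n} (h0 : p 0 = q 0)
    (h : ∀ r, pathStep p r = pathStep q r) : p = q := by
  funext i
  induction i using Fin.induction with
  | zero => exact h0
  | succ i ih =>
    have := h i
    simp only [pathStep, ih] at this
    exact Fin.ext (by omega)

theorem sum_pathStep {m n : ℕ} (p : Fin (m + 1) → Fin n) :
    ∑ r, pathStep p r = ((p (Fin.last m) : ℕ) : ℤ) - ((p 0 : ℕ) : ℤ) := by
  induction m with
  | zero => simp
  | succ m ih =>
    rw [Fin.sum_univ_castSucc]
    have := ih (fun i => p i.castSucc)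
    simp only [pathStep] at this ⊢
    simp only [Fin.castSucc_zero, Fin.succ_castSucc, Fin.succ_last] at this ⊢
    rw [this]
    ring

theorem pathStep_mem {m n : ℕ} (p : Fin (m + 1) → Fin n) (r : Fin m) :
    pathStep p r ∈ Finset.Ioo (-(n : ℤ)) n := by
  have h1 := (p r.succ).2
  have h2 := (p r.castSucc).2
  simp only [pathStep, Finset.mem_Ioo]
  omega

theorem pathStep_eq_of_pathKey_eq {ι : Type*} {m n : ℕ} {J : Fin m → ι} {e : Fin m → Bool}
    {c : Fin m → ℤ} {p q : Fin (m + 1) → Fin n} {r : Fin m}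
    (h : pathKey J e c p r = pathKey J e c q r) : pathStep p r = pathStep q r := by
  simp only [pathKey, Prod.mk.injEq, true_and, add_right_inj] at h
  exact mul_left_cancel₀ (letterSign_ne_zero _) h

/-! ### Counting paths with repeated keys -/

/-- The starting point and the increments in `T` form an injective code, and an increment takes at
most `2n - 1` values. -/
theorem card_paths_le_of_determined {m n : ℕ} (Q : Finset (Fin (m + 1) → Fin n))
    (T : Finset (Fin m))
    (h : ∀ p ∈ Q, ∀ q ∈ Q, p 0 = q 0 → (∀ r ∈ T, pathStep p r = pathStep q r) → p = q) :
    Q.card ≤ n * (2 * n) ^ T.card := by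
  classical
  have := Finset.card_le_card_of_injOn (s := Q)
    (t := (Finset.univ : Finset (Fin n)) ×ˢ
      Fintype.piFinset (fun _ : T => Finset.Ioo (-(n : ℤ)) n))
    (fun p => (p 0, fun r : T => pathStep p r)) ?_ ?_
  · refine this.trans ?_
    rw [Finset.card_product, Fintype.card_piFinset]
    simp only [Finset.card_univ, Fintype.card_fin, Int.card_Ioo, Finset.prod_const,
      Fintype.card_coe]
    gcongr
    omega
  · intro p _
    simp only [Finset.coe_product, Set.mem_prod, Finset.mem_coe, Finset.mem_univ, true_and,
      Fintype.mem_piFinset]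
    exact fun r => pathStep_mem p r
  · intro p hp q hq hpq
    simp only [Prod.mk.injEq] at hpq
    exact h p hp q hq hpq.1 fun r hr => congrFun hpq.2 ⟨r, hr⟩

/-- A choice of representatives of the level sets of `κ`. -/
def classRep {m : ℕ} {K : Type*} (κ : Fin m → K) (r : Fin m) : Fin m :=
  Set.rangeSplitting κ ⟨κ r, r, rfl⟩

theorem apply_classRep {m : ℕ} {K : Type*} (κ : Fin m → K) (r : Fin m) :
    κ (classRep κ r) = κ r := Set.apply_rangeSplitting κ ⟨κ r, r, rfl⟩

theorem classRep_eq_iff {m : ℕ} {K : Type*} (κ : Fin m → K) (r s : Fin m) :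
    classRep κ r = classRep κ s ↔ κ r = κ s := by
  constructor
  · intro h
    rw [← apply_classRep κ r, h, apply_classRep κ]
  · intro h
    simp only [classRep, h]

theorem two_le_card_fiber {m : ℕ} {K : Type*} {κ : Fin m → K} (h : IsMatched κ)
    {b : Fin m} (hb : b ∈ Finset.univ.image (classRep κ)) :
    2 ≤ (Finset.univ.filter fun r => classRep κ r = b).card := by
  obtain ⟨r, -, rfl⟩ := Finset.mem_image.1 hb
  obtain ⟨s, hs, hsr⟩ := h r
  refine Finset.one_lt_card.2 ⟨r, by simp, s, ?_, hs.symm⟩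
  simpa [classRep_eq_iff] using hsr

theorem two_mul_card_image_le {m : ℕ} {K : Type*} {κ : Fin m → K} (h : IsMatched κ) :
    2 * (Finset.univ.image (classRep κ)).card ≤ m := by
  have h1 := Finset.card_eq_sum_card_image (classRep κ) Finset.univ
  rw [Finset.card_univ, Fintype.card_fin] at h1
  rw [mul_comm, ← smul_eq_mul]
  conv_rhs => rw [h1]
  exact Finset.card_nsmul_le_sum _ _ _ fun b hb => two_le_card_fiber h hb

/-- The class sizes are all at least two and add up to twice the number of classes, so none can
exceed two. -/
theorem card_fiber_eq_two {m : ℕ} {K : Type*} {κ : Fin m → K} (h : IsMatched κ)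
    (hm : 2 * (Finset.univ.image (classRep κ)).card = m) {b : Fin m}
    (hb : b ∈ Finset.univ.image (classRep κ)) :
    (Finset.univ.filter fun r => classRep κ r = b).card = 2 := by
  have h1 := Finset.card_eq_sum_card_image (classRep κ) Finset.univ
  rw [Finset.card_univ, Fintype.card_fin] at h1
  have h2 : ∑ _b ∈ Finset.univ.image (classRep κ), 2 = m := by
    rw [Finset.sum_const, smul_eq_mul, mul_comm, hm]
  have h3 := (Finset.sum_eq_sum_iff_of_le fun b hb => two_le_card_fiber h hb).1 (h2.trans h1)
  exact (h3 b hb).symm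

/-- The involutions of the positions of a word that pair each letter with an adjoint of the
same letter. -/
def oppositePairings {ι : Type*} {m : ℕ} (J : Fin m → ι) (e : Fin m → Bool) :
    Finset (Fin m → Fin m) :=
  open Classical in Finset.univ.filter fun f =>
    (∀ r, f (f r) = r) ∧ (∀ r, J (f r) = J r) ∧ ∀ r, e (f r) = !e r

theorem mem_oppositePairings {ι : Type*} {m : ℕ} {J : Fin m → ι} {e : Fin m → Bool}
    {f : Fin m → Fin m} : f ∈ oppositePairings J e ↔
      (∀ r, f (f r) = r) ∧ (∀ r, J (f r) = J r) ∧ ∀ r, e (f r) = !e r := by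
  simp [oppositePairings]

theorem ne_of_mem_oppositePairings {ι : Type*} {m : ℕ} {J : Fin m → ι} {e : Fin m → Bool}
    {f : Fin m → Fin m} (hf : f ∈ oppositePairings J e) (r : Fin m) : f r ≠ r := by
  intro h
  have := (mem_oppositePairings.1 hf).2.2 r
  rw [h] at this
  cases h : e r <;> simp [h] at this

/-- The pairs of `f` are exactly the level sets of `κ`. -/
def IsExactPairing {m : ℕ} {K : Type*} (κ : Fin m → K) (f : Fin m → Fin m) : Prop :=
  ∀ r s, κ s = κ r ↔ s = r ∨ s = f r

/-- The extremal case of the count: all classes are pairs, and two signs with sum zero are opposite.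
Equality of the `J`-labels is the first coordinate of equality of keys. -/
theorem exists_pairing_of_card {ι : Type*} {m n : ℕ} {J : Fin m → ι} {e : Fin m → Bool}
    {c : Fin m → ℤ} {p : Fin (m + 1) → Fin n} (h : IsMatched (pathKey J e c p))
    (hm : 2 * (Finset.univ.image (classRep (pathKey J e c p))).card = m)
    (hs : ∀ b ∈ Finset.univ.image (classRep (pathKey J e c p)),
      ∑ r with classRep (pathKey J e c p) r = b, letterSign (e r) = 0) :
    ∃ f ∈ oppositePairings J e, IsExactPairing (pathKey J e c p) f := by
  classical
  choose f hf hκ using h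
  have hfib : ∀ r, (Finset.univ.filter fun s =>
      classRep (pathKey J e c p) s = classRep (pathKey J e c p) r) = {r, f r} := by
    intro r
    symm
    apply Finset.eq_of_subset_of_card_le
    · intro s hs
      rw [Finset.mem_insert, Finset.mem_singleton] at hs
      rcases hs with rfl | rfl
      · simp
      · simp [classRep_eq_iff, hκ]
    · rw [card_fiber_eq_two (fun r => ⟨f r, hf r, hκ r⟩) hm
        (Finset.mem_image_of_mem _ (Finset.mem_univ r)), Finset.card_pair (hf r).symm]
  have hex : IsExactPairing (pathKey J e c p) f := by
    intro r s
    have : s ∈ (Finset.univ.filter fun s =>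
      classRep (pathKey J e c p) s = classRep (pathKey J e c p) r) ↔ s ∈ ({r, f r} : Finset _) := by
      rw [hfib r]
    simpa [classRep_eq_iff] using this
  refine ⟨f, mem_oppositePairings.2 ⟨fun r => ?_, fun r => congrArg Prod.fst (hκ r),
    fun r => ?_⟩, hex⟩
  · have := (hex r (f (f r))).1 ((hκ (f r)).trans (hκ r))
    exact this.resolve_right (hf (f r))
  · have := hs _ (Finset.mem_image_of_mem _ (Finset.mem_univ r))
    rw [hfib r, Finset.sum_pair (hf r).symm] at this
    cases h1 : e r <;> cases h2 : e (f r) <;> simp [letterSign, h1, h2] at this ⊢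

/-- An increment and its key determine each other, so the increments at the representatives `σ r`
fix all keys and then all increments. -/
theorem card_paths_const_le {ι : Type*} {m n : ℕ} (J : Fin m → ι) (e : Fin m → Bool)
    (c : Fin m → ℤ) (σ : Fin m → Fin m) (Q : Finset (Fin (m + 1) → Fin n))
    (hQ : ∀ p ∈ Q, ∀ r, pathKey J e c p (σ r) = pathKey J e c p r) :
    Q.card ≤ n * (2 * n) ^ (Finset.univ.image σ).card := by
  refine card_paths_le_of_determined Q _ fun p hp q hq h0 h => path_ext h0 fun r => ?_
  refine pathStep_eq_of_pathKey_eq (J := J) (e := e) (c := c) ?_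
  rw [← hQ p hp, ← hQ q hq]
  simp only [pathKey, h _ (Finset.mem_image_of_mem σ (Finset.mem_univ r))]

/-- Closedness is a linear equation in the keys, where the key of the class of `b` has the sum of
the signs of that class as coefficient. As this is nonzero, the other classes determine that key,
which saves one factor `2n`. -/
theorem card_closed_paths_const_le {ι : Type*} {m n : ℕ} (J : Fin m → ι) (e : Fin m → Bool)
    (c : Fin m → ℤ) (σ : Fin m → Fin m) (Q : Finset (Fin (m + 1) → Fin n))
    (hQ : ∀ p ∈ Q, ∀ r, pathKey J e c p (σ r) = pathKey J e c p r)
    (hcl : ∀ p ∈ Q, p 0 = p (Fin.last m)) (b : Fin m)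
    (hb : ∑ r with σ r = b, letterSign (e r) ≠ 0) :
    Q.card ≤ n * (2 * n) ^ ((Finset.univ.image σ).erase b).card := by
  classical
  refine card_paths_le_of_determined Q _ fun p hp q hq h0 h => path_ext h0 fun r => ?_
  have hstep : ∀ p : Fin (m + 1) → Fin n, ∀ r,
      pathStep p r = letterSign (e r) * ((pathKey J e c p r).2 - c r) := by
    intro p r
    simp only [pathKey, add_sub_cancel_left, ← mul_assoc, letterSign_mul_self, one_mul]
  have hne : ∀ r, σ r ≠ b → pathKey J e c p r = pathKey J e c q r := by
    intro r hr
    rw [← hQ p hp, ← hQ q hq]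
    simp only [pathKey, h (σ r) (by simp [hr])]
  have hsum : ∑ r, (pathStep p r - pathStep q r) = 0 := by
    rw [Finset.sum_sub_distrib, sum_pathStep, sum_pathStep, hcl p hp, hcl q hq]
    ring
  have hdiff : ∀ r, pathStep p r - pathStep q r = if σ r = b then
      letterSign (e r) * ((pathKey J e c p b).2 - (pathKey J e c q b).2) else 0 := by
    intro r
    rw [hstep, hstep, ← hQ p hp r, ← hQ q hq r]
    split_ifs with hr
    · rw [hr]; ring
    · rw [hQ p hp r, hQ q hq r, hne r hr, sub_self]
  -- Only the class of `b` survives in the difference of the two closing equations: its sign sum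
  -- times the discrepancy of the key is zero.
  simp_rw [hdiff] at hsum
  rw [← Finset.sum_filter, ← Finset.sum_mul] at hsum
  have hz := (mul_eq_zero.1 hsum).resolve_left hb
  have := hdiff r
  rw [hz] at this
  simpa [sub_eq_zero] using this

theorem two_mul_pow_le_sqrt_pow {n t m : ℕ} (hn : 1 ≤ n) (h : 2 * t ≤ m) :
    ((2 * n : ℕ) : ℝ) ^ t ≤ 2 ^ m * Real.sqrt n ^ m := by
  have h1 : (1 : ℝ) ≤ Real.sqrt n := by
    rw [Real.one_le_sqrt]; exact_mod_cast hn
  have h2 : (n : ℝ) ^ t = Real.sqrt n ^ (2 * t) := by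
    rw [pow_mul, Real.sq_sqrt (Nat.cast_nonneg n)]
  rw [Nat.cast_mul, mul_pow, h2]
  have h3 : t ≤ m := by omega
  exact mul_le_mul (pow_le_pow_right₀ one_le_two h3) (pow_le_pow_right₀ h1 h) (by positivity)
    (by positivity)

/-- The number of paths all of whose keys are repeated. -/
theorem card_matched_le {ι : Type*} {m n : ℕ} (hn : 1 ≤ n) (J : Fin m → ι) (e : Fin m → Bool)
    (c : Fin m → ℤ) (Q : Finset (Fin (m + 1) → Fin n))
    (hQ : ∀ p ∈ Q, IsMatched (pathKey J e c p)) :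
    (Q.card : ℝ) ≤ (Fintype.card (Fin m → Fin m) * 2 ^ m : ℝ) * (n * Real.sqrt n ^ m) := by
  classical
  have h1 : Q.card ≤ ∑ σ : Fin m → Fin m,
      (Q.filter fun p => classRep (pathKey J e c p) = σ).card := by
    rw [← Finset.card_eq_sum_card_fiberwise (fun p _ => Finset.mem_univ _)]
  have h2 : ∀ σ : Fin m → Fin m,
      ((Q.filter fun p => classRep (pathKey J e c p) = σ).card : ℝ)
        ≤ n * (2 ^ m * Real.sqrt n ^ m) := by
    intro σ
    rcases (Q.filter fun p => classRep (pathKey J e c p) = σ).eq_empty_or_nonempty with h | h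
    · rw [h, Finset.card_empty, Nat.cast_zero]
      positivity
    · obtain ⟨p, hp⟩ := h
      rw [Finset.mem_filter] at hp
      have hc := two_mul_card_image_le (hQ p hp.1)
      rw [hp.2] at hc
      have h3 := card_paths_const_le J e c σ
        (Q.filter fun p => classRep (pathKey J e c p) = σ) (by
          intro p hp r
          rw [Finset.mem_filter] at hp
          rw [← hp.2, apply_classRep (pathKey J e c p)])
      calc ((Q.filter fun p => classRep (pathKey J e c p) = σ).card : ℝ)
          ≤ n * ((2 * n : ℕ) : ℝ) ^ (Finset.univ.image σ).card := by exact_mod_cast h3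
        _ ≤ _ := by gcongr; exact two_mul_pow_le_sqrt_pow hn hc
  calc (Q.card : ℝ) ≤ ∑ σ : Fin m → Fin m,
      ((Q.filter fun p => classRep (pathKey J e c p) = σ).card : ℝ) := by exact_mod_cast h1
    _ ≤ ∑ _σ : Fin m → Fin m, (n * (2 ^ m * Real.sqrt n ^ m) : ℝ) :=
        Finset.sum_le_sum fun σ _ => h2 σ
    _ = _ := by
        rw [Finset.sum_const, Finset.card_univ, nsmul_eq_mul]
        ring

/-- Closed paths whose keys are repeated but are not arranged in opposite pairs are few. -/
theorem card_not_paired_le {ι : Type*} {m n : ℕ} (hn : 1 ≤ n) (J : Fin m → ι)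
    (e : Fin m → Bool) (c : Fin m → ℤ) (Q : Finset (Fin (m + 1) → Fin n))
    (hQ : ∀ p ∈ Q, IsMatched (pathKey J e c p))
    (hcl : ∀ p ∈ Q, p 0 = p (Fin.last m))
    (hnp : ∀ p ∈ Q, ¬ ∃ f ∈ oppositePairings J e, IsExactPairing (pathKey J e c p) f) :
    (Q.card : ℝ) ≤
      (Fintype.card (Fin m → Fin m) * 2 ^ (m - 1) : ℝ) * (n * Real.sqrt n ^ (m - 1)) := by
  classical
  have h1 : Q.card ≤ ∑ σ : Fin m → Fin m,
      (Q.filter fun p => classRep (pathKey J e c p) = σ).card := by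
    rw [← Finset.card_eq_sum_card_fiberwise (fun p _ => Finset.mem_univ _)]
  have h2 : ∀ σ : Fin m → Fin m,
      ((Q.filter fun p => classRep (pathKey J e c p) = σ).card : ℝ)
        ≤ n * (2 ^ (m - 1) * Real.sqrt n ^ (m - 1)) := by
    intro σ
    rcases (Q.filter fun p => classRep (pathKey J e c p) = σ).eq_empty_or_nonempty with h | h
    · rw [h, Finset.card_empty, Nat.cast_zero]
      positivity
    · obtain ⟨p, hp⟩ := h
      rw [Finset.mem_filter] at hp
      have hc := two_mul_card_image_le (hQ p hp.1)
      have hconst : ∀ p ∈ Q.filter (fun p => classRep (pathKey J e c p) = σ), ∀ r,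
          pathKey J e c p (σ r) = pathKey J e c p r := by
        intro p hp r
        rw [Finset.mem_filter] at hp
        rw [← hp.2, apply_classRep (pathKey J e c p)]
      -- Here `t` counts the free increments: either there are fewer than `m/2` classes, or exactly
      -- `m/2` of them, one of which has nonzero sign sum and is removed by closedness.
      obtain ⟨t, ht, h3⟩ : ∃ t, 2 * t ≤ m - 1 ∧
          (Q.filter fun p => classRep (pathKey J e c p) = σ).card ≤ n * (2 * n) ^ t := by
        rcases hc.lt_or_eq with hlt | heq
        · rw [hp.2] at hlt
          exact ⟨_, by omega, card_paths_const_le J e c σ _ hconst⟩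
        · have : ∃ b ∈ Finset.univ.image σ, ∑ r with σ r = b, letterSign (e r) ≠ 0 := by
            by_contra! hcon
            refine hnp p hp.1 (exists_pairing_of_card (hQ p hp.1) heq ?_)
            rw [hp.2]
            exact hcon
          obtain ⟨b, hb, hbs⟩ := this
          rw [hp.2] at heq
          have hpos := Finset.card_pos.2 ⟨b, hb⟩
          exact ⟨_, by rw [Finset.card_erase_of_mem hb]; omega,
            card_closed_paths_const_le J e c σ _ hconst
              (fun p hp => hcl p (Finset.mem_filter.1 hp).1) b hbs⟩
      calc ((Q.filter fun p => classRep (pathKey J e c p) = σ).card : ℝ)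
          ≤ n * ((2 * n : ℕ) : ℝ) ^ t := by exact_mod_cast h3
        _ ≤ _ := by gcongr; exact two_mul_pow_le_sqrt_pow hn ht
  calc (Q.card : ℝ) ≤ ∑ σ : Fin m → Fin m,
      ((Q.filter fun p => classRep (pathKey J e c p) = σ).card : ℝ) := by exact_mod_cast h1
    _ ≤ ∑ _σ : Fin m → Fin m, (n * (2 ^ (m - 1) * Real.sqrt n ^ (m - 1)) : ℝ) :=
        Finset.sum_le_sum fun σ _ => h2 σ
    _ = _ := by
        rw [Finset.sum_const, Finset.card_univ, nsmul_eq_mul]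
        ring

/-! ### Moments of words in independent variables -/

/-- A complex number or its conjugate. -/
def letterEval (b : Bool) (z : ℂ) : ℂ := if b then star z else z

theorem norm_letterEval (b : Bool) (z : ℂ) : ‖letterEval b z‖ = ‖z‖ := by
  cases b <;> simp [letterEval]

theorem measurable_letterEval (b : Bool) : Measurable (letterEval b) := by
  cases b
  · exact measurable_id
  · exact continuous_star.measurable

/-- The product is at most the `m`-th power of the largest factor; the summand `1` covers the empty
product. Moments of the single order `m` thus control every word of length `m`. -/
theorem prod_le_one_add_sum_pow {m : ℕ} (a : Fin m → ℝ) (ha : ∀ r, 0 ≤ a r) :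
    ∏ r, a r ≤ 1 + ∑ r, a r ^ m := by
  rcases isEmpty_or_nonempty (Fin m) with h | h
  · simp
  · obtain ⟨r₀, hr₀⟩ := Finite.exists_max a
    calc ∏ r, a r ≤ ∏ _r : Fin m, a r₀ :=
          Finset.prod_le_prod (fun r _ => ha r) fun r _ => hr₀ r
      _ = a r₀ ^ m := by simp
      _ ≤ ∑ r, a r ^ m :=
          Finset.single_le_sum (f := fun r => a r ^ m) (fun r _ => pow_nonneg (ha r) m)
            (Finset.mem_univ r₀)
      _ ≤ _ := by linarith

theorem norm_prod_letterEval_le {Ω L : Type*} {X : L → Ω → ℂ} {m : ℕ}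
    (κ : Fin m → L) (e : Fin m → Bool) (ω : Ω) :
    ‖∏ r, letterEval (e r) (X (κ r) ω)‖ ≤ 1 + ∑ r, ‖X (κ r) ω‖ ^ m := by
  rw [norm_prod]
  simp_rw [norm_letterEval]
  exact prod_le_one_add_sum_pow _ fun _ => norm_nonneg _

section Moments

variable {Ω L : Type*} [MeasurableSpace Ω] {P : Measure Ω}
  {X : L → Ω → ℂ}

theorem measurable_prod_letterEval (hX : ∀ l, Measurable (X l)) {m : ℕ} (κ : Fin m → L)
    (e : Fin m → Bool) : Measurable fun ω => ∏ r, letterEval (e r) (X (κ r) ω) :=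
  Finset.measurable_fun_prod _ fun _ _ => (measurable_letterEval _).comp (hX _)

theorem integrable_one_add_sum [IsProbabilityMeasure P] (hX : IsStandardizedInput P X)
    {m : ℕ} (κ : Fin m → L) :
    Integrable (fun ω => 1 + ∑ r, ‖X (κ r) ω‖ ^ m) P := by
  obtain ⟨C, hC⟩ := hX.bounded_moments m
  exact (integrable_const _).add (integrable_finsetSum _ fun r _ => (hC _).1)

theorem integrable_prod_letterEval [IsProbabilityMeasure P]
    (hX : IsStandardizedInput P X) {m : ℕ} (κ : Fin m → L)
    (e : Fin m → Bool) : Integrable (fun ω => ∏ r, letterEval (e r) (X (κ r) ω)) P :=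
  (integrable_one_add_sum hX κ).mono'
    (measurable_prod_letterEval hX.measurable κ e).aestronglyMeasurable
    (ae_of_all _ fun ω => norm_prod_letterEval_le κ e ω)

theorem exists_bound_integral_prod_letterEval [IsProbabilityMeasure P]
    (hX : IsStandardizedInput P X) (m : ℕ) :
    ∃ C : ℝ, 0 ≤ C ∧ ∀ (κ : Fin m → L) (e : Fin m → Bool),
      ‖∫ ω, ∏ r, letterEval (e r) (X (κ r) ω) ∂P‖ ≤ C := by
  obtain ⟨C, hC⟩ := hX.bounded_moments m
  refine ⟨1 + m * |C|, by positivity, fun κ e => ?_⟩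
  calc ‖∫ ω, ∏ r, letterEval (e r) (X (κ r) ω) ∂P‖
      ≤ ∫ ω, (1 + ∑ r, ‖X (κ r) ω‖ ^ m) ∂P :=
        norm_integral_le_of_norm_le (integrable_one_add_sum hX κ)
          (ae_of_all _ fun ω => norm_prod_letterEval_le κ e ω)
    _ = 1 + ∑ r, ∫ ω, ‖X (κ r) ω‖ ^ m ∂P := by
        rw [integral_add (integrable_const _) (integrable_finsetSum _ fun r _ => (hC _).1),
          integral_finsetSum _ fun r _ => (hC _).1]
        simp
    _ ≤ 1 + ∑ _r : Fin m, |C| := by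
        gcongr with _
        exact (hC _).2.trans (le_abs_self C)
    _ = _ := by simp

/-- Grouping the factors by the variable they involve turns the product into one of functions of
distinct, hence independent, variables. -/
theorem integral_prod_letterEval_eq (hX : IsStandardizedInput P X) {m : ℕ} [DecidableEq L]
    (κ : Fin m → L) (e : Fin m → Bool) :
    ∫ ω, ∏ r, letterEval (e r) (X (κ r) ω) ∂P = ∏ l ∈ Finset.univ.image κ,
      ∫ ω, ∏ r with κ r = l, letterEval (e r) (X l ω) ∂P := by
  have h1 : ∀ ω, ∏ r, letterEval (e r) (X (κ r) ω) = ∏ l : Finset.univ.image κ,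
      (fun z : ℂ => ∏ r with κ r = l, letterEval (e r) z) (X l ω) := by
    intro ω
    rw [Finset.prod_coe_sort (Finset.univ.image κ)
      (fun l => ∏ r with κ r = l, letterEval (e r) (X l ω)),
      ← Finset.prod_fiberwise_of_maps_to (g := κ) (t := Finset.univ.image κ)
        (fun r _ => Finset.mem_image_of_mem κ (Finset.mem_univ r))]
    refine Finset.prod_congr rfl fun l _ => Finset.prod_congr rfl fun r hr => ?_
    rw [(Finset.mem_filter.1 hr).2]
  simp_rw [h1]
  have hind : iIndepFun (fun l : Finset.univ.image κ => X l) P :=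
    hX.indep.precomp Subtype.val_injective
  rw [hind.integral_fun_prod_comp (fun l => (hX.measurable l).aemeasurable) fun l =>
    (Finset.measurable_fun_prod _ fun r _ => measurable_letterEval (e r)).aestronglyMeasurable]
  exact Finset.prod_coe_sort (Finset.univ.image κ)
    (fun l => ∫ ω, ∏ r with κ r = l, letterEval (e r) (X l ω) ∂P)

theorem integral_letterEval (hX : IsStandardizedInput P X) (b : Bool) (l : L) :
    ∫ ω, letterEval b (X l ω) ∂P = 0 := by
  cases b
  · simpa [letterEval] using hX.mean_zero l
  · have := integral_conj (μ := P) (f := X l)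
    rw [hX.mean_zero l, map_zero] at this
    simpa [letterEval] using this

theorem integral_prod_letterEval_of_not_matched (hX : IsStandardizedInput P X) {m : ℕ}
    (κ : Fin m → L) (e : Fin m → Bool) (h : ¬ IsMatched κ) :
    ∫ ω, ∏ r, letterEval (e r) (X (κ r) ω) ∂P = 0 := by
  classical
  simp only [IsMatched, not_forall, not_exists, not_and] at h
  obtain ⟨r, hr⟩ := h
  rw [integral_prod_letterEval_eq hX]
  refine Finset.prod_eq_zero (Finset.mem_image_of_mem κ (Finset.mem_univ r)) ?_
  have : (Finset.univ.filter fun s => κ s = κ r) = {r} := by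
    ext s
    simp only [Finset.mem_filter, Finset.mem_univ, true_and, Finset.mem_singleton]
    exact ⟨fun h => by_contra fun hs => hr s hs h, fun h => h ▸ rfl⟩
  simp_rw [this, Finset.prod_singleton]
  exact integral_letterEval hX _ _

/-- Each variable occurs once plainly and once conjugated, so its factor is the mean of its squared
modulus. -/
theorem integral_prod_letterEval_of_exactPairing (hX : IsStandardizedInput P X) {m : ℕ}
    (κ : Fin m → L) (e : Fin m → Bool) {f : Fin m → Fin m} (he : ∀ r, e (f r) = !e r)
    (h : IsExactPairing κ f) :
    ∫ ω, ∏ r, letterEval (e r) (X (κ r) ω) ∂P = 1 := by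
  classical
  rw [integral_prod_letterEval_eq hX]
  refine Finset.prod_eq_one fun l hl => ?_
  obtain ⟨r, -, rfl⟩ := Finset.mem_image.1 hl
  have hfr : r ≠ f r := by
    intro hr
    have := he r
    rw [← hr] at this
    cases h : e r <;> simp [h] at this
  have : (Finset.univ.filter fun s => κ s = κ r) = {r, f r} := by
    ext s
    simp only [Finset.mem_filter, Finset.mem_univ, true_and, Finset.mem_insert,
      Finset.mem_singleton]
    exact h r s
  have h2 : ∀ z : ℂ, letterEval (e r) z * letterEval (!e r) z = ((‖z‖ ^ 2 : ℝ) : ℂ) := by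
    intro z
    have h3 : z * (starRingEnd ℂ) z = ((‖z‖ ^ 2 : ℝ) : ℂ) := by
      rw [Complex.mul_conj, Complex.normSq_eq_norm_sq]
    cases e r
    · simpa [letterEval] using h3
    · simpa [letterEval, mul_comm] using h3
  simp_rw [this, Finset.prod_pair hfr, he, h2]
  rw [integral_complex_ofReal, hX.unit_variance, Complex.ofReal_one]

end Moments

/-! ### Products of matrices as sums over paths -/

theorem prod_ofFn_matrix_apply {R : Type*} [CommRing R] {m n : ℕ}
    (M : Fin m → Matrix (Fin n) (Fin n) R) (i j : Fin n) :
    (List.ofFn M).prod i j = ∑ p : Fin (m + 1) → Fin n,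
      if p 0 = i ∧ p (Fin.last m) = j then ∏ r : Fin m, M r (p r.castSucc) (p r.succ) else 0 := by
  induction m generalizing i with
  | zero =>
    rw [← (Equiv.funUnique (Fin 1) (Fin n)).symm.sum_comp]
    simp only [List.ofFn_zero, List.prod_nil, Matrix.one_apply, Equiv.funUnique_symm_apply,
      uniqueElim_const, Finset.univ_eq_empty, Finset.prod_empty, ite_and, Finset.sum_ite_eq',
      Finset.mem_univ, if_true]
  | succ m ih =>
    rw [← (Fin.consEquiv fun _ : Fin (m + 2) => Fin n).sum_comp, Fintype.sum_prod_type,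
      List.ofFn_succ, List.prod_cons, Matrix.mul_apply]
    simp_rw [ih, Finset.mul_sum]
    have : ∀ (a : Fin n) (q : Fin (m + 1) → Fin n),
        (if (Fin.consEquiv fun _ : Fin (m + 2) => Fin n) (a, q) 0 = i ∧
            (Fin.consEquiv fun _ : Fin (m + 2) => Fin n) (a, q) (Fin.last (m + 1)) = j then
          ∏ r : Fin (m + 1), M r ((Fin.consEquiv fun _ : Fin (m + 2) => Fin n) (a, q) r.castSucc)
            ((Fin.consEquiv fun _ : Fin (m + 2) => Fin n) (a, q) r.succ) else 0) =
        if a = i then (if q (Fin.last m) = j then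
          M 0 i (q 0) * ∏ r : Fin m, M r.succ (q r.castSucc) (q r.succ) else 0) else 0 := by
      intro a q
      simp only [Fin.consEquiv_apply, Fin.cons_zero, ← Fin.succ_last, Fin.cons_succ, ite_and]
      split_ifs with h1 h2
      · rw [Fin.prod_univ_succ]
        simp [h1]
      · rfl
      · rfl
    simp_rw [this]
    rw [Finset.sum_comm, Finset.sum_comm (s := Finset.univ (α := Fin n))]
    refine Finset.sum_congr rfl fun q _ => ?_
    simp only [Finset.sum_ite_eq', Finset.mem_univ, if_true, ite_and, mul_ite, mul_zero]
    simp

theorem trace_prod_ofFn_matrix {R : Type*} [CommRing R] {m n : ℕ}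
    (M : Fin m → Matrix (Fin n) (Fin n) R) :
    (List.ofFn M).prod.trace = ∑ p : Fin (m + 1) → Fin n with p 0 = p (Fin.last m),
      ∏ r : Fin m, M r (p r.castSucc) (p r.succ) := by
  simp only [Matrix.trace, Matrix.diag_apply, prod_ofFn_matrix_apply]
  rw [Finset.sum_comm, Finset.sum_filter]
  refine Finset.sum_congr rfl fun p _ => ?_
  simp only [ite_and, Finset.sum_ite_eq, Finset.mem_univ, if_true]
  simp [eq_comm]

/-! ### Lattice points in the polytope of a pairing -/

section Polytope

open scoped Pointwise

variable {m : ℕ} (e : Fin m → Bool) (f : Fin m → Fin m)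

/-- The increment at time `r` of the walk with free parameters `x`. -/
def walkStep {R : Type*} [Ring R] (x : Option {r // e r = false} → R) (r : Fin m) : R :=
  if h : e r = false then x (some ⟨r, h⟩)
  else if h' : e (f r) = false then -x (some ⟨f r, h'⟩) else 0

/-- The walk whose free parameters are its starting point and its increments at the times `r`
with `e r = false`, the other increments being opposite to the paired ones. -/
def pairedWalk {R : Type*} [Ring R] (x : Option {r // e r = false} → R) (i : Fin (m + 1)) : R :=
  x none + ∑ r : Fin m with r.castSucc < i, walkStep e f x r

theorem pairedWalk_zero {R : Type*} [Ring R] (x : Option {r // e r = false} → R) :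
    pairedWalk e f x 0 = x none := by
  simp [pairedWalk]

theorem pairedWalk_succ {R : Type*} [Ring R] (x : Option {r // e r = false} → R) (r : Fin m) :
    pairedWalk e f x r.succ = pairedWalk e f x r.castSucc + walkStep e f x r := by
  classical
  have : (Finset.univ.filter fun s : Fin m => s.castSucc < r.succ) =
      insert r (Finset.univ.filter fun s : Fin m => s.castSucc < r.castSucc) := by
    ext s
    simp only [Finset.mem_filter, Finset.mem_univ, true_and, Finset.mem_insert, Fin.lt_def,
      Fin.val_castSucc, Fin.val_succ, Fin.ext_iff]
    omega
  rw [pairedWalk, this, Finset.sum_insert (by simp), pairedWalk]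
  abel

theorem isLinearMap_walkStep (r : Fin m) :
    IsLinearMap ℝ fun x : Option {r // e r = false} → ℝ => walkStep e f x r := by
  constructor
  · intro x y
    simp only [walkStep]
    split_ifs <;> simp [add_comm]
  · intro c x
    simp only [walkStep]
    split_ifs <;> simp

theorem isLinearMap_pairedWalk (i : Fin (m + 1)) :
    IsLinearMap ℝ fun x : Option {r // e r = false} → ℝ => pairedWalk e f x i := by
  constructor
  · intro x y
    simp only [pairedWalk, (isLinearMap_walkStep e f _).map_add, Finset.sum_add_distrib,
      Pi.add_apply]
    ring
  · intro c x
    simp only [pairedWalk, (isLinearMap_walkStep e f _).map_smul, ← Finset.smul_sum,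
      Pi.smul_apply, smul_add]

theorem pairedWalk_div (z : Option {r // e r = false} → ℤ) (a : ℝ) (i : Fin (m + 1)) :
    pairedWalk e f (fun o => (z o : ℝ) / a) i = (pairedWalk e f z i : ℤ) / a := by
  have hstep : ∀ r, walkStep e f (fun o => (z o : ℝ) / a) r = (walkStep e f z r : ℤ) / a := by
    intro r
    simp only [walkStep]
    split_ifs <;> push_cast <;> ring
  simp only [pairedWalk, hstep]
  push_cast
  rw [add_div, Finset.sum_div]

/-- The parameters of the walks that stay in the unit interval. -/
def pairingPolytope : Set (Option {r // e r = false} → ℝ) :=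
  {x | ∀ i, pairedWalk e f x i ∈ Set.Ico (0 : ℝ) 1}

theorem convex_pairingPolytope : Convex ℝ (pairingPolytope e f) := by
  have : pairingPolytope e f = ⋂ i, (fun x => pairedWalk e f x i) ⁻¹' Set.Ico (0 : ℝ) 1 := by
    ext x; simp [pairingPolytope]
  rw [this]
  exact convex_iInter fun i => (convex_Ico 0 1).is_linear_preimage (isLinearMap_pairedWalk e f i)

theorem measurableSet_pairingPolytope : MeasurableSet (pairingPolytope e f) := by
  have : pairingPolytope e f = ⋂ i, (fun x => pairedWalk e f x i) ⁻¹' Set.Ico (0 : ℝ) 1 := by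
    ext x; simp [pairingPolytope]
  rw [this]
  refine MeasurableSet.iInter fun i => ?_
  have : Continuous fun x : Option {r // e r = false} → ℝ => pairedWalk e f x i :=
    LinearMap.continuous_of_finiteDimensional (isLinearMap_pairedWalk e f i).mk'
  exact this.measurable measurableSet_Ico

/-- Every parameter is either the starting point or a difference of two consecutive positions, all
lying in `[0, 1)`. -/
theorem isBounded_pairingPolytope : Bornology.IsBounded (pairingPolytope e f) := by
  refine (Metric.isBounded_closedBall (x := (0 : Option {r // e r = false} → ℝ))
    (r := 1)).subset fun x hx => ?_
  rw [mem_closedBall_zero_iff, pi_norm_le_iff_of_nonneg zero_le_one]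
  intro o
  rw [Real.norm_eq_abs, abs_le]
  rcases o with _ | ⟨r, hr⟩
  · have := hx 0
    rw [pairedWalk_zero] at this
    exact ⟨by linarith [this.1], this.2.le⟩
  · have h1 := hx r.castSucc
    have h2 := hx r.succ
    rw [pairedWalk_succ] at h2
    have h3 : walkStep e f x r = x (some ⟨r, hr⟩) := by simp [walkStep, hr]
    rw [h3] at h2
    exact ⟨by linarith [h1.1, h1.2, h2.1, h2.2], by linarith [h1.1, h1.2, h2.1, h2.2]⟩

/-- The paths whose increments are opposite at paired times. -/
def pairedPaths (n : ℕ) : Finset (Fin (m + 1) → Fin n) :=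
  Finset.univ.filter fun p => ∀ r, pathStep p (f r) = -pathStep p r

variable {e f}

/-- Dividing the starting point and the free increments of a path by `n` gives a bijection onto the
points of the lattice `n⁻¹ ℤ` in the polytope; the inverse rebuilds the walk from its integer
parameters. -/
theorem card_pairedPaths (hf : ∀ r, f (f r) = r) (he : ∀ r, e (f r) = !e r) {n : ℕ}
    (hn : 1 ≤ n) :
    Nat.card ↑(pairingPolytope e f ∩ (n : ℝ)⁻¹ •
      (Submodule.span ℤ (Set.range (Pi.basisFun ℝ (Option {r // e r = false}))) :
        Set (Option {r // e r = false} → ℝ))) = (pairedPaths f n).card := by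
  have hn0 : (0 : ℝ) < n := by exact_mod_cast hn
  let z : (Fin (m + 1) → Fin n) → Option {r // e r = false} → ℤ := fun p o =>
    o.elim ((p 0 : ℕ) : ℤ) fun r => pathStep p r
  let F : (Fin (m + 1) → Fin n) → Option {r // e r = false} → ℝ := fun p o => (z p o : ℝ) / n
  have hwstep : ∀ p ∈ pairedPaths f n, ∀ r, walkStep e f (z p) r = pathStep p r := by
    intro p hp r
    simp only [pairedPaths, Finset.mem_filter, Finset.mem_univ, true_and] at hp
    simp only [walkStep]
    split_ifs with h1 h2
    · rfl
    · change -pathStep p (f r) = _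
      rw [hp, neg_neg]
    -- The default value of `walkStep` is never used, because `f` reverses `e`.
    · exact absurd (by rw [he]; simpa using h1) h2
  have hwalk : ∀ p ∈ pairedPaths f n, ∀ i, pairedWalk e f (z p) i = ((p i : ℕ) : ℤ) := by
    intro p hp i
    induction i using Fin.induction with
    | zero => rw [pairedWalk_zero]; rfl
    | succ r ih => rw [pairedWalk_succ, ih, hwstep p hp, pathStep]; ring
  have hzF : ∀ p q, F p = F q → z p = z q := by
    intro p q h
    funext o
    have := congrFun h o
    simp only [F] at this
    rw [div_left_inj' hn0.ne'] at this
    exact_mod_cast this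
  have hinj : Set.InjOn F (pairedPaths f n) := by
    intro p hp q hq hpq
    have h1 := hzF p q hpq
    funext i
    have h2 := hwalk p hp i
    rw [h1, hwalk q hq i] at h2
    exact Fin.ext (by exact_mod_cast h2.symm)
  have himage : pairingPolytope e f ∩ (n : ℝ)⁻¹ •
      (Submodule.span ℤ (Set.range (Pi.basisFun ℝ (Option {r // e r = false}))) :
        Set (Option {r // e r = false} → ℝ)) = F '' (pairedPaths f n) := by
    ext x
    constructor
    · rintro ⟨hx, y, hy, rfl⟩
      rw [SetLike.mem_coe, Module.Basis.mem_span_iff_repr_mem] at hy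
      simp only [Pi.basisFun_repr, algebraMap_int_eq, Set.mem_range, eq_intCast] at hy
      choose u hu using hy
      have hxu : (fun y : Option {r // e r = false} → ℝ => (n : ℝ)⁻¹ • y) y =
          fun o => (u o : ℝ) / n := by
        funext o
        simp only [Pi.smul_apply, smul_eq_mul, hu]
        ring
      rw [hxu] at hx ⊢
      have hb : ∀ i, 0 ≤ pairedWalk e f u i ∧ pairedWalk e f u i < n := by
        intro i
        have := hx i
        rw [pairedWalk_div, Set.mem_Ico, le_div_iff₀ hn0, div_lt_one hn0, zero_mul] at this
        exact_mod_cast this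
      let p : Fin (m + 1) → Fin n := fun i =>
        ⟨(pairedWalk e f u i).toNat, by have := hb i; omega⟩
      have hp : ∀ i, ((p i : ℕ) : ℤ) = pairedWalk e f u i := fun i => Int.toNat_of_nonneg (hb i).1
      have hps : ∀ r, pathStep p r = walkStep e f u r := by
        intro r
        rw [pathStep, hp, hp, pairedWalk_succ]
        ring
      refine ⟨p, ?_, ?_⟩
      · simp only [pairedPaths, Finset.coe_filter, Finset.mem_univ, true_and, Set.mem_ofPred_eq]
        intro r
        rw [hps, hps]
        simp only [walkStep, hf, he]
        rcases Bool.eq_false_or_eq_true (e r) with h | h <;> simp [h]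
      · funext o
        simp only [F]
        congr 2
        rcases o with _ | ⟨r, hr⟩
        · change ((p 0 : ℕ) : ℤ) = _
          rw [hp, pairedWalk_zero]
        · change pathStep p r = _
          rw [hps]
          simp [walkStep, hr]
    · rintro ⟨p, hp, rfl⟩
      refine ⟨fun i => ?_, ?_⟩
      · rw [pairedWalk_div, hwalk p hp]
        constructor
        · positivity
        · rw [div_lt_one hn0]
          exact_mod_cast (p i).2
      · refine ⟨fun o => (z p o : ℝ), ?_, ?_⟩
        · rw [SetLike.mem_coe, Module.Basis.mem_span_iff_repr_mem]
          intro o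
          exact ⟨z p o, by simp⟩
        · funext o
          simp only [Pi.smul_apply, smul_eq_mul, F]
          ring
  rw [himage, Nat.card_image_of_injOn hinj]
  simp

theorem two_mul_card_eq (hf : ∀ r, f (f r) = r) (he : ∀ r, e (f r) = !e r) :
    2 * Fintype.card {r // e r = false} = m := by
  have h1 : Fintype.card {r // e r = false} = Fintype.card {r // ¬ e r = false} :=
    Fintype.card_congr
      { toFun := fun r => ⟨f r, by rw [he, r.2]; simp⟩
        invFun := fun r => ⟨f r, by rw [he]; simpa using r.2⟩
        left_inv := fun r => Subtype.ext (hf r)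
        right_inv := fun r => Subtype.ext (hf r) }
  have h2 := Fintype.card_subtype_compl (fun r => e r = false)
  have h3 := Fintype.card_subtype_le (fun r => e r = false)
  rw [Fintype.card_fin] at h2 h3
  omega

/-- A bounded convex set has a null frontier, so its rescaled lattice point count tends to its
volume. The dimension is `m/2 + 1`, since `f` exchanges the letters and the adjoints; this matches
the scaling `n · √n ^ m`. -/
theorem tendsto_card_pairedPaths (hf : ∀ r, f (f r) = r) (he : ∀ r, e (f r) = !e r) :
    Tendsto (fun n : ℕ => ((pairedPaths f n).card : ℝ) / (n * Real.sqrt n ^ m)) atTop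
      (𝓝 (volume.real (pairingPolytope e f))) := by
  refine (tendsto_card_div_pow_atTop_volume (pairingPolytope e f)
    (isBounded_pairingPolytope e f) (measurableSet_pairingPolytope e f)
    ((convex_pairingPolytope e f).addHaar_frontier volume)).congr' ?_
  filter_upwards [eventually_ge_atTop 1] with n hn
  rw [card_pairedPaths hf he hn, Fintype.card_option, pow_succ' (n : ℝ)]
  congr 2
  conv_rhs => rw [← two_mul_card_eq hf he]
  rw [pow_mul, Real.sq_sqrt (Nat.cast_nonneg n)]

end Polytope

/-! ### Expected traces of words in weighted Toeplitz matrices -/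

theorem starWord_eq_prod_ofFn {ι A : Type*} [Monoid A] [Star A] (a : ι → A)
    (w : List (ι × Bool)) : starWord a w = (List.ofFn fun r : Fin w.length =>
      if (w.get r).2 then star (a (w.get r).1) else a (w.get r).1).prod := by
  conv_lhs => rw [starWord, ← List.ofFn_get w, List.map_ofFn]
  rfl

theorem prod_ofFn_apply {Ω R : Type*} [Monoid R] {m : ℕ} (M : Fin m → Ω → R) (ω : Ω) :
    (List.ofFn M).prod ω = (List.ofFn fun r => M r ω).prod := by
  have := map_list_prod (Pi.evalMonoidHom (fun _ : Ω => R) ω) (List.ofFn M)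
  rw [List.map_ofFn] at this
  exact this

/-- The matrix of weights `g` times entries `letterEval b (X (j, c ± (i' - i)))` at `(i, i')`. -/
def IsWeightedToeplitz {Ω ι : Type*} {n : ℕ} (X : ι × ℤ → Ω → ℂ) (j : ι) (b : Bool) (c : ℤ)
    (g : Fin n → Fin n → ℂ) (M : Ω → Matrix (Fin n) (Fin n) ℂ) : Prop :=
  ∀ ω i i', M ω i i' = ((Real.sqrt n : ℝ) : ℂ)⁻¹ * g i i' *
    letterEval b (X (j, c + letterSign b * (((i' : ℕ) : ℤ) - ((i : ℕ) : ℤ))) ω)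

section Trace

variable {Ω ι : Type*} {X : ι × ℤ → Ω → ℂ}
  {m n : ℕ} {J : Fin m → ι} {e : Fin m → Bool} {c : Fin m → ℤ} {g : Fin m → Fin n → Fin n → ℂ}
  {M : Fin m → Ω → Matrix (Fin n) (Fin n) ℂ}

/-- The expectation of the product of the entries along a path. -/
def pathMoment [MeasurableSpace Ω] (P : Measure Ω) (X : ι × ℤ → Ω → ℂ) (J : Fin m → ι) (e : Fin m → Bool)
    (c : Fin m → ℤ) (p : Fin (m + 1) → Fin n) : ℂ :=
  ∫ ω, ∏ r, letterEval (e r) (X (pathKey J e c p r) ω) ∂P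

theorem trace_prod_weightedToeplitz (hM : ∀ r, IsWeightedToeplitz X (J r) (e r) (c r) (g r) (M r))
    (ω : Ω) :
    ((List.ofFn M).prod ω).trace = ∑ p : Fin (m + 1) → Fin n with p 0 = p (Fin.last m),
      (((Real.sqrt n : ℝ) : ℂ)⁻¹ ^ m * ∏ r, g r (p r.castSucc) (p r.succ)) *
        ∏ r, letterEval (e r) (X (pathKey J e c p r) ω) := by
  rw [prod_ofFn_apply, trace_prod_ofFn_matrix]
  refine Finset.sum_congr rfl fun p _ => ?_
  simp_rw [hM _ ω, Finset.prod_mul_distrib, Finset.prod_const, Finset.card_univ,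
    Fintype.card_fin]
  rfl

theorem integrable_trace_weightedToeplitz [MeasurableSpace Ω] {P : Measure Ω}
    [IsProbabilityMeasure P]
    (hX : IsStandardizedInput P X)
    (hM : ∀ r, IsWeightedToeplitz X (J r) (e r) (c r) (g r) (M r)) :
    Integrable (fun ω => ((List.ofFn M).prod ω).trace) P := by
  simp_rw [trace_prod_weightedToeplitz hM]
  exact integrable_finsetSum _ fun p _ => (integrable_prod_letterEval hX _ e).const_mul _

theorem expectedTrace_weightedToeplitz [MeasurableSpace Ω] {P : Measure Ω}
    [IsProbabilityMeasure P]
    (hX : IsStandardizedInput P X)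
    (hM : ∀ r, IsWeightedToeplitz X (J r) (e r) (c r) (g r) (M r)) :
    expectedTrace P n (List.ofFn M).prod = (n : ℂ)⁻¹ *
      ∑ p : Fin (m + 1) → Fin n with p 0 = p (Fin.last m),
      (((Real.sqrt n : ℝ) : ℂ)⁻¹ ^ m * ∏ r, g r (p r.castSucc) (p r.succ)) *
        pathMoment P X J e c p := by
  rw [expectedTrace]
  simp_rw [trace_prod_weightedToeplitz hM]
  rw [integral_finsetSum _ fun p _ => (integrable_prod_letterEval hX _ e).const_mul _]
  simp_rw [integral_const_mul]
  rfl

end Trace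

/-! ### Uniform bounds and limits of expected traces -/

section Limit

variable {Ω ι : Type*} [MeasurableSpace Ω] {P : Measure Ω} [IsProbabilityMeasure P]
  {X : ι × ℤ → Ω → ℂ}

/-- Only matched paths contribute, and their number is at most a constant times `n · √n ^ m`. The
constant is uniform in the weights and the shifts `c`, as the ultrafilter limit requires. -/
theorem exists_bound_expectedTrace_weightedToeplitz (hX : IsStandardizedInput P X) (m : ℕ) :
    ∃ K : ℝ, ∀ (n : ℕ) (J : Fin m → ι) (e : Fin m → Bool) (c : Fin m → ℤ)
      (g : Fin m → Fin n → Fin n → ℂ) (M : Fin m → Ω → Matrix (Fin n) (Fin n) ℂ),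
      (∀ r i i', ‖g r i i'‖ ≤ 1) →
      (∀ r, IsWeightedToeplitz X (J r) (e r) (c r) (g r) (M r)) →
      ‖expectedTrace P n (List.ofFn M).prod‖ ≤ K := by
  classical
  obtain ⟨C, hC0, hC⟩ := exists_bound_integral_prod_letterEval hX m
  refine ⟨Fintype.card (Fin m → Fin m) * 2 ^ m * C, fun n J e c g M hg hM => ?_⟩
  rcases Nat.eq_zero_or_pos n with rfl | hn
  · simp only [expectedTrace, CharP.cast_eq_zero, inv_zero, zero_mul, norm_zero]
    positivity
  have hn0 : (0 : ℝ) < n := by exact_mod_cast hn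
  have hs : 0 < Real.sqrt n := Real.sqrt_pos.2 hn0
  rw [expectedTrace_weightedToeplitz hX hM, norm_mul, norm_inv, Complex.norm_natCast]
  have h1 : ∀ p : Fin (m + 1) → Fin n,
      ‖(((Real.sqrt n : ℝ) : ℂ)⁻¹ ^ m * ∏ r, g r (p r.castSucc) (p r.succ)) *
        pathMoment P X J e c p‖ ≤
      if IsMatched (pathKey J e c p) then (Real.sqrt n)⁻¹ ^ m * C else 0 := by
    intro p
    split_ifs with h
    · rw [norm_mul, norm_mul, norm_pow, norm_inv, Complex.norm_real,
        Real.norm_of_nonneg (Real.sqrt_nonneg _), norm_prod]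
      have : ∏ r, ‖g r (p r.castSucc) (p r.succ)‖ ≤ 1 :=
        Finset.prod_le_one (fun r _ => norm_nonneg _) fun r _ => hg r _ _
      have h3 : ‖pathMoment P X J e c p‖ ≤ C := hC _ _
      have h4 : (Real.sqrt n)⁻¹ ^ m * ∏ r, ‖g r (p r.castSucc) (p r.succ)‖ ≤
          (Real.sqrt n)⁻¹ ^ m := mul_le_of_le_one_right (by positivity) this
      exact mul_le_mul h4 h3 (norm_nonneg _) (by positivity)
    · rw [pathMoment, integral_prod_letterEval_of_not_matched hX _ _ h]
      simp
  have h2 : ‖∑ p : Fin (m + 1) → Fin n with p 0 = p (Fin.last m),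
      (((Real.sqrt n : ℝ) : ℂ)⁻¹ ^ m * ∏ r, g r (p r.castSucc) (p r.succ)) *
        pathMoment P X J e c p‖ ≤
      (Fintype.card (Fin m → Fin m) * 2 ^ m : ℝ) * (n * Real.sqrt n ^ m) *
        ((Real.sqrt n)⁻¹ ^ m * C) := by
    refine (norm_sum_le_of_le _ fun p _ => h1 p).trans ?_
    rw [← Finset.sum_filter, Finset.sum_const, nsmul_eq_mul]
    gcongr
    exact card_matched_le hn J e c _ fun p hp => (Finset.mem_filter.1 hp).2
  calc (n : ℝ)⁻¹ * _ ≤ (n : ℝ)⁻¹ * ((Fintype.card (Fin m → Fin m) * 2 ^ m : ℝ) *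
        (n * Real.sqrt n ^ m) * ((Real.sqrt n)⁻¹ ^ m * C)) := by gcongr
    _ = _ := by
        rw [inv_pow]
        field_simp

/-- Reindexing by the involution shows that the total increment equals its own negative. -/
theorem closed_of_mem_pairedPaths {m n : ℕ} {f : Fin m → Fin m} (hf : ∀ r, f (f r) = r)
    {p : Fin (m + 1) → Fin n} (hp : p ∈ pairedPaths f n) : p 0 = p (Fin.last m) := by
  simp only [pairedPaths, Finset.mem_filter, Finset.mem_univ, true_and] at hp
  have h1 := sum_pathStep p
  have h2 : ∑ r, pathStep p (f r) = ∑ r, pathStep p r :=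
    Equiv.sum_comp (Function.Involutive.toPerm f hf) (pathStep p)
  simp_rw [hp, Finset.sum_neg_distrib] at h2
  exact Fin.ext (by omega)

/-- Paired letters carry opposite signs, so with zero shifts opposite increments mean equal keys. -/
theorem mem_pairedPaths_iff {m n : ℕ} {J : Fin m → ι} {e : Fin m → Bool}
    {f : Fin m → Fin m} (hf : f ∈ oppositePairings J e) {p : Fin (m + 1) → Fin n} :
    p ∈ pairedPaths f n ↔ ∀ r, pathKey J e 0 p (f r) = pathKey J e 0 p r := by
  obtain ⟨-, h2, h3⟩ := mem_oppositePairings.1 hf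
  simp only [pairedPaths, Finset.mem_filter, Finset.mem_univ, true_and, pathKey, h2, h3,
    Prod.mk.injEq, Pi.zero_apply, zero_add]
  refine forall_congr' fun r => ?_
  cases e r <;> simp [letterSign, neg_eq_iff_eq_neg]

/-- The limiting `*`-moment of the Toeplitz matrices. -/
def toeplitzMoment {m : ℕ} (J : Fin m → ι) (e : Fin m → Bool) : ℝ :=
  ∑ f ∈ oppositePairings J e, volume.real (pairingPolytope e f)

/-- The comparison is made path by path. The mean along a path equals the number of pairings
compatible with it (zero or one), except on the matched paths without exact opposite pairing, which
`card_not_paired_le` shows to be few. -/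
theorem exists_bound_sum_pathMoment_sub (hX : IsStandardizedInput P X) {m : ℕ}
    (J : Fin m → ι) (e : Fin m → Bool) : ∃ K : ℝ, 0 ≤ K ∧ ∀ n : ℕ, 1 ≤ n →
      ‖∑ p : Fin (m + 1) → Fin n with p 0 = p (Fin.last m), pathMoment P X J e 0 p -
        ∑ f ∈ oppositePairings J e, ((pairedPaths f n).card : ℂ)‖ ≤
      K * (n * Real.sqrt n ^ (m - 1)) := by
  classical
  obtain ⟨C, hC0, hC⟩ := exists_bound_integral_prod_letterEval hX m
  refine ⟨(Fintype.card (Fin m → Fin m) * 2 ^ (m - 1)) * (C + (oppositePairings J e).card),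
    by positivity, fun n hn => ?_⟩
  have h1 : ∑ f ∈ oppositePairings J e, ((pairedPaths f n).card : ℂ) =
      ∑ p : Fin (m + 1) → Fin n with p 0 = p (Fin.last m),
        ∑ f ∈ oppositePairings J e, if p ∈ pairedPaths f n then (1 : ℂ) else 0 := by
    rw [Finset.sum_comm]
    refine Finset.sum_congr rfl fun f hf => ?_
    rw [Finset.sum_boole]
    congr 2
    ext p
    simp only [Finset.mem_filter, Finset.mem_univ, true_and]
    exact ⟨fun h => ⟨closed_of_mem_pairedPaths (mem_oppositePairings.1 hf).1 h, h⟩, fun h => h.2⟩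
  rw [h1, ← Finset.sum_sub_distrib]
  let bad : (Fin (m + 1) → Fin n) → Prop := fun p => IsMatched (pathKey J e 0 p) ∧
    ¬ ∃ f ∈ oppositePairings J e, IsExactPairing (pathKey J e 0 p) f
  have h2 : ∀ p : Fin (m + 1) → Fin n, ‖pathMoment P X J e 0 p -
      ∑ f ∈ oppositePairings J e, if p ∈ pairedPaths f n then (1 : ℂ) else 0‖ ≤
      if bad p then C + (oppositePairings J e).card else 0 := by
    intro p
    split_ifs with hb
    · refine (norm_sub_le _ _).trans (add_le_add (hC _ _) ?_)
      refine (norm_sum_le_of_le (f := fun f => if p ∈ pairedPaths f n then (1 : ℂ) else 0)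
        (n := fun _ => 1) _ fun f _ => ?_).trans ?_
      · split_ifs <;> simp
      · simp
    · rw [norm_le_zero_iff, sub_eq_zero]
      by_cases hm : IsMatched (pathKey J e 0 p)
      · obtain ⟨f₀, hf₀, hex⟩ : ∃ f ∈ oppositePairings J e,
          IsExactPairing (pathKey J e 0 p) f := by
          by_contra h
          exact hb ⟨hm, h⟩
        rw [pathMoment, integral_prod_letterEval_of_exactPairing hX _ _
          (mem_oppositePairings.1 hf₀).2.2 hex, Finset.sum_eq_single_of_mem f₀ hf₀]
        · rw [if_pos]
          rw [mem_pairedPaths_iff hf₀]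
          exact fun r => (hex r (f₀ r)).2 (Or.inr rfl)
        -- The exact pairing is the only compatible one: any other would send `r` to a different
        -- position with the same key, which must be `f₀ r`.
        · intro f hf hne
          rw [if_neg]
          rw [mem_pairedPaths_iff hf]
          intro h
          refine hne (funext fun r => ?_)
          exact ((hex r (f r)).1 (h r)).resolve_left (ne_of_mem_oppositePairings hf r)
      · rw [pathMoment, integral_prod_letterEval_of_not_matched hX _ _ hm]
        refine (Finset.sum_eq_zero fun f hf => if_neg fun h => hm fun r => ?_).symm
        exact ⟨f r, ne_of_mem_oppositePairings hf r, (mem_pairedPaths_iff hf).1 h r⟩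
  refine (norm_sum_le_of_le _ fun p _ => h2 p).trans ?_
  rw [← Finset.sum_filter, Finset.sum_const, nsmul_eq_mul]
  have h3 := card_not_paired_le hn J e 0
    (((Finset.univ : Finset (Fin (m + 1) → Fin n)).filter fun p => p 0 = p (Fin.last m)).filter
      fun p => bad p)
    (fun p hp => (Finset.mem_filter.1 hp).2.1)
    (fun p hp => (Finset.mem_filter.1 (Finset.mem_filter.1 hp).1).2)
    (fun p hp => (Finset.mem_filter.1 hp).2.2)
  calc _ ≤ (Fintype.card (Fin m → Fin m) * 2 ^ (m - 1) : ℝ) * (n * Real.sqrt n ^ (m - 1)) *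
        (C + (oppositePairings J e).card) := by gcongr
    _ = _ := by ring

theorem tendsto_expectedTrace_toeplitz (hX : IsStandardizedInput P X) {m : ℕ}
    (J : Fin m → ι) (e : Fin m → Bool) (M : ∀ n, Fin m → Ω → Matrix (Fin n) (Fin n) ℂ)
    (hM : ∀ n r, IsWeightedToeplitz X (J r) (e r) 0 (fun _ _ => 1) (M n r)) :
    Tendsto (fun n => expectedTrace P n (List.ofFn (M n)).prod) atTop
      (𝓝 (toeplitzMoment J e : ℂ)) := by
  obtain ⟨K, hK0, hK⟩ := exists_bound_sum_pathMoment_sub hX J e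
  have hform : ∀ n, expectedTrace P n (List.ofFn (M n)).prod =
      (n * ((Real.sqrt n : ℝ) : ℂ) ^ m)⁻¹ *
        ∑ p : Fin (m + 1) → Fin n with p 0 = p (Fin.last m), pathMoment P X J e 0 p := by
    intro n
    rw [expectedTrace_weightedToeplitz (c := 0) hX (hM n)]
    simp only [Finset.prod_const_one, mul_one, ← Finset.mul_sum, mul_inv, inv_pow]
    ring
  have hmain : Tendsto (fun n : ℕ => (n * ((Real.sqrt n : ℝ) : ℂ) ^ m)⁻¹ *
      ∑ f ∈ oppositePairings J e, ((pairedPaths f n).card : ℂ)) atTop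
      (𝓝 (toeplitzMoment J e : ℂ)) := by
    have : Tendsto (fun n : ℕ => ∑ f ∈ oppositePairings J e,
        ((pairedPaths f n).card : ℝ) / (n * Real.sqrt n ^ m)) atTop (𝓝 (toeplitzMoment J e)) := by
      refine tendsto_finsetSum _ fun f hf => ?_
      obtain ⟨h1, -, h3⟩ := mem_oppositePairings.1 hf
      exact tendsto_card_pairedPaths h1 h3
    refine ((Complex.continuous_ofReal.tendsto _).comp this).congr fun n => ?_
    simp only [Function.comp_apply]
    push_cast
    rw [Finset.mul_sum]
    exact Finset.sum_congr rfl fun f _ => by rw [div_eq_inv_mul]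
  have herr : Tendsto (fun n : ℕ => (n * ((Real.sqrt n : ℝ) : ℂ) ^ m)⁻¹ *
      (∑ p : Fin (m + 1) → Fin n with p 0 = p (Fin.last m), pathMoment P X J e 0 p -
        ∑ f ∈ oppositePairings J e, ((pairedPaths f n).card : ℂ))) atTop (𝓝 0) := by
    -- For the empty word `m - 1` truncates to `0` and the error bound does not decay; the two sums
    -- agree exactly there.
    rcases Nat.eq_zero_or_pos m with rfl | hm
    · refine (tendsto_const_nhds (x := (0 : ℂ))).congr' ?_
      filter_upwards [eventually_ge_atTop 1] with n hn
      symm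
      rw [mul_eq_zero, sub_eq_zero]
      right
      have h1 : oppositePairings J e = {id} := by
        ext f
        rw [mem_oppositePairings, Finset.mem_singleton]
        exact ⟨fun _ => Subsingleton.elim _ _, fun _ => ⟨fun r => r.elim0, fun r => r.elim0,
          fun r => r.elim0⟩⟩
      have h2 : pairedPaths (id : Fin 0 → Fin 0) n = Finset.univ := by
        ext p
        simp [pairedPaths]
      rw [h1, Finset.sum_singleton, h2]
      simp [pathMoment]
    · have hs : Tendsto (fun n : ℕ => K * (Real.sqrt n)⁻¹) atTop (𝓝 0) := by
        have := ((tendsto_inv_atTop_zero.comp Real.tendsto_sqrt_atTop).comp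
          tendsto_natCast_atTop_atTop).const_mul K
        rwa [mul_zero] at this
      refine squeeze_zero_norm' ?_ hs
      filter_upwards [eventually_ge_atTop 1] with n hn
      have hn0 : (0 : ℝ) < n := by exact_mod_cast hn
      have hs0 : 0 < Real.sqrt n := Real.sqrt_pos.2 hn0
      rw [norm_mul, norm_inv, norm_mul, norm_pow, Complex.norm_natCast, Complex.norm_real,
        Real.norm_of_nonneg hs0.le]
      calc (n * Real.sqrt n ^ m)⁻¹ * _
          ≤ (n * Real.sqrt n ^ m)⁻¹ * (K * (n * Real.sqrt n ^ (m - 1))) := by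
            gcongr
            exact hK n hn
        _ = K * (Real.sqrt n)⁻¹ := by
            obtain ⟨l, rfl⟩ : ∃ l, m = l + 1 := ⟨m - 1, by omega⟩
            rw [Nat.add_sub_cancel, pow_succ]
            field_simp
  have := herr.add hmain
  rw [zero_add] at this
  refine this.congr fun n => ?_
  rw [hform, ← mul_add, sub_add_cancel]

end Limit

/-! ### Words in Toeplitz matrices -/

theorem isWeightedToeplitz_scaledToeplitz {Ω ι : Type*} (τ : ι → ℤ → Ω → ℂ) (j : ι) (b : Bool) (n : ℕ) :
    IsWeightedToeplitz (fun l : ι × ℤ => τ l.1 l.2) j b 0 (fun _ _ => 1)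
      (if b then star (scaledToeplitz (τ j) n) else scaledToeplitz (τ j) n) := by
  intro ω i i'
  cases b
  · simp [scaledToeplitz, randomToeplitz, letterEval, letterSign]
  · simp [scaledToeplitz, randomToeplitz, letterEval, letterSign, Matrix.star_apply]

theorem integrable_trace_starWord_scaledToeplitz {Ω ι : Type*} [MeasurableSpace Ω]
    {P : Measure Ω} [IsProbabilityMeasure P] {τ : ι → ℤ → Ω → ℂ}
    (hτ : IsStandardizedInput P (fun l : ι × ℤ => τ l.1 l.2)) (n : ℕ) (w : List (ι × Bool)) :
    Integrable (fun ω => (starWord (fun j => scaledToeplitz (τ j) n) w ω).trace) P := by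
  rw [starWord_eq_prod_ofFn]
  exact integrable_trace_weightedToeplitz (c := 0) hτ
    fun r => isWeightedToeplitz_scaledToeplitz τ (w.get r).1 (w.get r).2 n

theorem tendsto_expectedTrace_starWord {Ω ι : Type*} [MeasurableSpace Ω]
    {P : Measure Ω} [IsProbabilityMeasure P] {τ : ι → ℤ → Ω → ℂ}
    (hτ : IsStandardizedInput P (fun l : ι × ℤ => τ l.1 l.2)) (w : List (ι × Bool)) :
    Tendsto (fun n => expectedTrace P n (starWord (fun j => scaledToeplitz (τ j) n) w)) atTop
      (𝓝 (toeplitzMoment (fun r => (w.get r).1) (fun r => (w.get r).2) : ℂ)) := by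
  simp_rw [starWord_eq_prod_ofFn]
  exact tendsto_expectedTrace_toeplitz hτ _ _ _
    fun n r => isWeightedToeplitz_scaledToeplitz τ (w.get r).1 (w.get r).2 n

/-! ### The standard complex Gaussian law -/

theorem measurable_ofReal_add_ofReal_mul_I :
    Measurable fun p : ℝ × ℝ => (p.1 : ℂ) + (p.2 : ℂ) * Complex.I := by fun_prop

instance isProbabilityMeasure_stdComplexGaussian : IsProbabilityMeasure stdComplexGaussian :=
  Measure.isProbabilityMeasure_map measurable_ofReal_add_ofReal_mul_I.aemeasurable

theorem charFun_stdComplexGaussian (t : ℂ) :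
    charFun stdComplexGaussian t = Complex.exp (-((‖t‖ ^ 2 / 4 : ℝ) : ℂ)) := by
  rw [charFun_apply, stdComplexGaussian,
    integral_map measurable_ofReal_add_ofReal_mul_I.aemeasurable
      (by fun_prop)]
  have h : ∀ p : ℝ × ℝ, Complex.exp
      ((inner ℝ ((p.1 : ℂ) + (p.2 : ℂ) * Complex.I) t : ℝ) * Complex.I) =
      Complex.exp ((t.re : ℂ) * p.1 * Complex.I) * Complex.exp ((t.im : ℂ) * p.2 * Complex.I) := by
    intro p
    rw [← Complex.exp_add, Complex.inner]
    congr 1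
    simp
    ring
  simp_rw [h]
  rw [integral_prod_mul (fun x : ℝ => Complex.exp ((t.re : ℂ) * x * Complex.I))
    (fun x : ℝ => Complex.exp ((t.im : ℂ) * x * Complex.I)), ← charFun_apply_real,
    ← charFun_apply_real, charFun_gaussianReal, charFun_gaussianReal, ← Complex.exp_add]
  congr 1
  rw [← Complex.normSq_eq_norm_sq, Complex.normSq_apply]
  push_cast
  simp
  ring

theorem charFun_map_const_mul_stdComplexGaussian (u t : ℂ) :
    charFun (stdComplexGaussian.map fun z => u * z) t =
      Complex.exp (-((‖u‖ ^ 2 * ‖t‖ ^ 2 / 4 : ℝ) : ℂ)) := by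
  have h : charFun (stdComplexGaussian.map fun z => u * z) t =
      charFun stdComplexGaussian (starRingEnd ℂ u * t) := by
    rw [charFun_apply, charFun_apply, integral_map (by fun_prop) (by fun_prop)]
    simp_rw [Complex.inner, map_mul]
    refine integral_congr_ae (ae_of_all _ fun z => ?_)
    simp only
    congr 4
    ring
  rw [h, charFun_stdComplexGaussian, norm_mul, RCLike.norm_conj, mul_pow]

/-- Unit combinations of independent standard complex Gaussian variables are standard complex
Gaussian. -/
theorem map_sum_mul_eq_stdComplexGaussian {Ω L : Type*} [MeasurableSpace Ω] {P : Measure Ω}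
    {X : L → Ω → ℂ} (hm : ∀ l, Measurable (X l)) (hind : iIndepFun X P)
    (hlaw : ∀ l, P.map (X l) = stdComplexGaussian) (s : Finset L) (u : L → ℂ)
    (hu : ∑ l ∈ s, ‖u l‖ ^ 2 = 1) :
    P.map (fun ω => ∑ l ∈ s, u l * X l ω) = stdComplexGaussian := by
  have := hind.isProbabilityMeasure
  have hm' : ∀ l, Measurable fun ω => u l * X l ω := fun l => (hm l).const_mul _
  have : IsProbabilityMeasure (P.map fun ω => ∑ l ∈ s, u l * X l ω) :=
    Measure.isProbabilityMeasure_map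
      (Finset.measurable_fun_sum _ fun l _ => hm' l).aemeasurable
  have hind' : iIndepFun (fun l ω => u l * X l ω) P :=
    hind.comp (fun l z => u l * z) fun l => measurable_const_mul _
  refine Measure.ext_of_charFun (funext fun t => ?_)
  rw [(hind'.restrict s).charFun_map_fun_finsetSum_eq_prod fun l _ => (hm' l).aemeasurable,
    Finset.prod_apply, charFun_stdComplexGaussian]
  have h1 : ∀ l, charFun (P.map fun ω => u l * X l ω) t =
      Complex.exp (-((‖u l‖ ^ 2 * ‖t‖ ^ 2 / 4 : ℝ) : ℂ)) := by
    intro l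
    rw [← charFun_map_const_mul_stdComplexGaussian, ← hlaw l,
      Measure.map_map (measurable_const_mul _) (hm l)]
    rfl
  simp_rw [h1]
  rw [← Complex.exp_sum, Finset.sum_neg_distrib, ← Complex.ofReal_sum, ← Finset.sum_div,
    ← Finset.sum_mul, hu, one_mul]

theorem memLp_id_stdComplexGaussian (p : ℕ) : MemLp id p stdComplexGaussian := by
  have h1 : MemLp (fun x : ℝ => (x : ℂ)) p (gaussianReal 0 (1 / 2)) :=
    (memLp_id_gaussianReal' (p : ENNReal) (ENNReal.natCast_ne_top p)).ofReal
  rw [stdComplexGaussian, memLp_map_measure_iff (by fun_prop)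
    measurable_ofReal_add_ofReal_mul_I.aemeasurable]
  have h2 := h1.comp_fst (gaussianReal 0 (1 / 2))
  have h3 := (h1.comp_snd (gaussianReal 0 (1 / 2))).mul_const Complex.I
  exact h2.add h3

theorem integrable_norm_pow_stdComplexGaussian (p : ℕ) :
    Integrable (fun z : ℂ => ‖z‖ ^ p) stdComplexGaussian := by
  rcases Nat.eq_zero_or_pos p with rfl | hp
  · simp
  · exact (memLp_id_stdComplexGaussian p).integrable_norm_pow hp.ne'

theorem integral_id_stdComplexGaussian : ∫ z, z ∂stdComplexGaussian = 0 := by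
  have h1 : Integrable (fun x : ℝ => (x : ℂ)) (gaussianReal 0 (1 / 2)) :=
    (memLp_one_iff_integrable.1 (memLp_id_gaussianReal' 1 ENNReal.one_ne_top)).ofReal
  have h0 : ∫ x : ℝ, (x : ℂ) ∂gaussianReal 0 (1 / 2) = 0 := by
    rw [integral_complex_ofReal, integral_id_gaussianReal, Complex.ofReal_zero]
  rw [stdComplexGaussian, integral_map measurable_ofReal_add_ofReal_mul_I.aemeasurable
      (by fun_prop), integral_add (h1.comp_fst _) ((h1.comp_snd _).mul_const _),
    integral_mul_const, integral_fun_fst (fun x : ℝ => (x : ℂ)),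
    integral_fun_snd (fun x : ℝ => (x : ℂ)), h0]
  simp

theorem integral_norm_sq_stdComplexGaussian : ∫ z, ‖z‖ ^ 2 ∂stdComplexGaussian = 1 := by
  have h1 : Integrable (fun x : ℝ => x ^ 2) (gaussianReal 0 (1 / 2)) :=
    (memLp_id_gaussianReal' 2 ENNReal.ofNat_ne_top).integrable_sq
  have h0 : ∫ x : ℝ, x ^ 2 ∂gaussianReal 0 (1 / 2) = 1 / 2 := by
    have := variance_fun_id_gaussianReal (μ := 0) (v := 1 / 2)
    rw [variance_of_integral_eq_zero (by fun_prop) integral_id_gaussianReal] at this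
    simpa using this
  have h2 : ∀ p : ℝ × ℝ, ‖(p.1 : ℂ) + (p.2 : ℂ) * Complex.I‖ ^ 2 = p.1 ^ 2 + p.2 ^ 2 := by
    intro p
    rw [← Complex.normSq_eq_norm_sq, Complex.normSq_add_mul_I]
  rw [stdComplexGaussian, integral_map measurable_ofReal_add_ofReal_mul_I.aemeasurable
      (by fun_prop)]
  simp_rw [h2]
  rw [integral_add (h1.comp_fst _) (h1.comp_snd _),
    integral_fun_fst (fun x : ℝ => x ^ 2), integral_fun_snd (fun x : ℝ => x ^ 2), h0]
  simp
  norm_num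

theorem isStandardizedInput_of_map_eq {Ω L : Type*} [MeasurableSpace Ω] {P : Measure Ω}
    {X : L → Ω → ℂ} (hm : ∀ l, Measurable (X l)) (hind : iIndepFun X P)
    (hlaw : ∀ l, P.map (X l) = stdComplexGaussian) : IsStandardizedInput P X where
  measurable := hm
  indep := hind
  mean_zero l := by
    rw [← integral_id_stdComplexGaussian, ← hlaw l,
      integral_map (hm l).aemeasurable (by fun_prop)]
  unit_variance l := by
    rw [← integral_norm_sq_stdComplexGaussian, ← hlaw l,
      integral_map (hm l).aemeasurable (by fun_prop)]
  bounded_moments p := by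
    refine ⟨∫ z, ‖z‖ ^ p ∂stdComplexGaussian, fun l => ⟨?_, ?_⟩⟩
    · have := integrable_norm_pow_stdComplexGaussian p
      rw [← hlaw l] at this
      exact this.comp_measurable (hm l)
    · rw [← hlaw l, integral_map (hm l).aemeasurable (by fun_prop)]

/-! ### Fourier phases -/

/-- The character `x ↦ exp (2 π i (m + θ) x / n)` of `ℤ`. -/
def phase (θ : ℝ) (n m : ℕ) (x : ℤ) : ℂ :=
  Complex.exp (((2 * Real.pi * (m + θ) * x / n : ℝ) : ℂ) * Complex.I)

theorem phase_add (θ : ℝ) (n m : ℕ) (x y : ℤ) :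
    phase θ n m (x + y) = phase θ n m x * phase θ n m y := by
  rw [phase, phase, phase, ← Complex.exp_add]
  congr 1
  push_cast
  ring

theorem norm_phase (θ : ℝ) (n m : ℕ) (x : ℤ) : ‖phase θ n m x‖ = 1 :=
  Complex.norm_exp_ofReal_mul_I _

theorem star_phase (θ : ℝ) (n m : ℕ) (x : ℤ) : star (phase θ n m x) = phase θ n m (-x) := by
  rw [phase, phase, Complex.star_def, ← Complex.exp_conj, map_mul, Complex.conj_ofReal,
    Complex.conj_I]
  congr 1
  push_cast
  ring

theorem phase_eq_mul_pow (θ : ℝ) (n m : ℕ) (x : ℤ) :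
    phase θ n m x = phase θ n 0 x * phase 0 n 1 x ^ m := by
  rw [phase, phase, phase, ← Complex.exp_nat_mul, ← Complex.exp_add]
  congr 1
  push_cast
  ring

theorem phase_zero_one_eq_one_iff {n : ℕ} (hn : 1 ≤ n) (x : ℤ) :
    phase 0 n 1 x = 1 ↔ (n : ℤ) ∣ x := by
  have hn0 : (n : ℂ) ≠ 0 := by exact_mod_cast (by omega : n ≠ 0)
  have hpi : (2 * Real.pi * Complex.I : ℂ) ≠ 0 := Complex.two_pi_I_ne_zero
  rw [phase, Complex.exp_eq_one_iff]
  constructor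
  · rintro ⟨c, hc⟩
    refine ⟨c, ?_⟩
    have h : (x : ℂ) = n * c := by
      push_cast at hc
      field_simp at hc
      apply mul_left_cancel₀ hpi
      linear_combination (2 * Real.pi * Complex.I : ℂ) * hc
    exact_mod_cast h
  · rintro ⟨c, rfl⟩
    refine ⟨c, ?_⟩
    push_cast
    field_simp
    ring

/-- Orthogonality of characters: the twist factors out, leaving a geometric sum of an `n`-th root of
unity. -/
theorem sum_phase (θ : ℝ) {n : ℕ} (hn : 1 ≤ n) (x : ℤ) :
    ∑ m : Fin n, phase θ n m x = if (n : ℤ) ∣ x then n * phase θ n 0 x else 0 := by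
  rw [Finset.sum_congr rfl fun (m : Fin n) _ => phase_eq_mul_pow θ n m x]
  rw [← Finset.mul_sum, Fin.sum_univ_eq_sum_range (fun m => phase 0 n 1 x ^ m)]
  split_ifs with h
  · rw [(phase_zero_one_eq_one_iff hn x).2 h]
    simp only [one_pow, Finset.sum_const, Finset.card_range, nsmul_eq_mul, mul_one]
    exact mul_comm _ _
  · have h1 : phase 0 n 1 x ≠ 1 := fun h' => h ((phase_zero_one_eq_one_iff hn x).1 h')
    have h2 : phase 0 n 1 x ^ n = 1 := by
      have hn0 : (n : ℂ) ≠ 0 := by exact_mod_cast (by omega : n ≠ 0)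
      rw [phase, ← Complex.exp_nat_mul, Complex.exp_eq_one_iff]
      refine ⟨x, ?_⟩
      push_cast
      field_simp
      ring
    rw [geom_sum_eq h1, h2]
    simp

/-- The matrix of the (twisted) discrete Fourier transform. -/
def fourierMatrix (θ : ℝ) (n : ℕ) : Matrix (Fin n) (Fin n) ℂ :=
  Matrix.of fun i m => ((Real.sqrt n : ℝ) : ℂ)⁻¹ * phase θ n m ((i : ℕ) : ℤ)

theorem inv_sqrt_mul_inv_sqrt (n : ℕ) :
    ((Real.sqrt n : ℝ) : ℂ)⁻¹ * ((Real.sqrt n : ℝ) : ℂ)⁻¹ = (n : ℂ)⁻¹ := by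
  rw [← mul_inv, ← Complex.ofReal_mul, Real.mul_self_sqrt (Nat.cast_nonneg n),
    Complex.ofReal_natCast]

theorem fourierMatrix_mul_diagonal_mul_apply (θ : ℝ) (n : ℕ) (v : Fin n → ℂ) (i i' : Fin n) :
    (fourierMatrix θ n * Matrix.diagonal v * star (fourierMatrix θ n)) i i' =
      (n : ℂ)⁻¹ * ∑ m : Fin n, phase θ n m (((i : ℕ) : ℤ) - ((i' : ℕ) : ℤ)) * v m := by
  rw [Matrix.mul_apply, Finset.mul_sum]
  refine Finset.sum_congr rfl fun m _ => ?_
  rw [Matrix.mul_diagonal, Matrix.star_apply, fourierMatrix, Matrix.of_apply, Matrix.of_apply,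
    star_mul', star_phase, sub_eq_add_neg, phase_add, ← inv_sqrt_mul_inv_sqrt, Complex.star_def,
    map_inv₀, Complex.conj_ofReal]
  ring

theorem fourierMatrix_mul_star (θ : ℝ) (n : ℕ) :
    fourierMatrix θ n * star (fourierMatrix θ n) = 1 := by
  ext i i'
  have hn : 1 ≤ n := i.pos
  have hn0 : (n : ℂ) ≠ 0 := by exact_mod_cast (by omega : n ≠ 0)
  have h := fourierMatrix_mul_diagonal_mul_apply θ n (fun _ => 1) i i'
  rw [Matrix.diagonal_one, mul_one] at h
  rw [h]
  simp_rw [mul_one]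
  rw [sum_phase θ hn, Matrix.one_apply]
  by_cases hi : i = i'
  · simp [hi, phase, hn0]
  · rw [if_neg hi, if_neg, mul_zero]
    intro hd
    have h1 := i.2
    have h2 := i'.2
    have h3 : ((i : ℕ) : ℤ) - ((i' : ℕ) : ℤ) = 0 :=
      Int.eq_zero_of_abs_lt_dvd hd (by rw [abs_lt]; omega)
    exact hi (Fin.ext (by omega))

theorem star_mul_fourierMatrix (θ : ℝ) (n : ℕ) :
    star (fourierMatrix θ n) * fourierMatrix θ n = 1 :=
  mul_eq_one_comm.1 (fourierMatrix_mul_star θ n)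

/-! ### The Gaussian model -/

/-- Independent standard complex Gaussian variables indexed by `Fin k × ℤ`. -/
def gaussianArray (k : ℕ) : Measure (Fin k → ℤ → ℂ) :=
  Measure.infinitePi fun _ => Measure.infinitePi fun _ => stdComplexGaussian

instance isProbabilityMeasure_gaussianArray (k : ℕ) : IsProbabilityMeasure (gaussianArray k) := by
  unfold gaussianArray
  infer_instance

theorem isStandardizedInput_gaussianArray (k : ℕ) : IsStandardizedInput (gaussianArray k)
    (fun (l : Fin k × ℤ) (ω : Fin k → ℤ → ℂ) => ω l.1 l.2) := by
  refine isStandardizedInput_of_map_eq (fun l => by fun_prop)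
    (iIndepFun_uncurry_infinitePi' (X := fun _ _ z => z) (fun _ _ => stdComplexGaussian)
      fun _ _ => measurable_id) fun l => ?_
  have h1 := measurePreserving_eval_infinitePi
    (fun _ : Fin k => Measure.infinitePi fun _ : ℤ => stdComplexGaussian) l.1
  have h2 := measurePreserving_eval_infinitePi (fun _ : ℤ => stdComplexGaussian) l.2
  exact (h2.comp h1).map_eq

/-- The eigenvalues of the (twisted) circulant part of a Toeplitz matrix. -/
def circulantEigenvalue (θ : ℝ) (n m : ℕ) (t : ℤ → ℂ) : ℂ :=
  ∑ x ∈ Finset.Ico (-(n : ℤ)) n,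
    (((Real.sqrt 2 : ℝ) : ℂ)⁻¹ * ((Real.sqrt n : ℝ) : ℂ)⁻¹ * phase θ n m x) * t x

theorem measurable_circulantEigenvalue (θ : ℝ) (n m : ℕ) : Measurable (circulantEigenvalue θ n m) :=
  Finset.measurable_fun_sum _ fun x _ => (measurable_pi_apply x).const_mul _

/-- There are `2n` coefficients of squared modulus `1/(2n)`. Including the index `-n`, which `T_n`
does not use, makes the variance exactly one for every `n`. -/
theorem map_circulantEigenvalue (θ : ℝ) {n : ℕ} (hn : 1 ≤ n) (m : ℕ) :
    (Measure.infinitePi fun _ : ℤ => stdComplexGaussian).map (circulantEigenvalue θ n m) =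
      stdComplexGaussian := by
  refine map_sum_mul_eq_stdComplexGaussian (X := fun (x : ℤ) (t : ℤ → ℂ) => t x)
    (fun x => measurable_pi_apply x)
    (iIndepFun_infinitePi (X := fun _ z => z) fun _ => measurable_id)
    (fun x => (measurePreserving_eval_infinitePi (fun _ : ℤ => stdComplexGaussian) x).map_eq)
    _ _ ?_
  have hn0 : (n : ℝ) ≠ 0 := by exact_mod_cast (by omega : n ≠ 0)
  have h : ∀ x, ‖((Real.sqrt 2 : ℝ) : ℂ)⁻¹ * ((Real.sqrt n : ℝ) : ℂ)⁻¹ * phase θ n m x‖ ^ 2 =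
      (2 * n : ℝ)⁻¹ := by
    intro x
    rw [norm_mul, norm_phase, mul_one, norm_mul, norm_inv, norm_inv, Complex.norm_real,
      Complex.norm_real, Real.norm_of_nonneg (Real.sqrt_nonneg _),
      Real.norm_of_nonneg (Real.sqrt_nonneg _), mul_pow, inv_pow, inv_pow,
      Real.sq_sqrt (by norm_num), Real.sq_sqrt (Nat.cast_nonneg n), mul_inv]
  simp_rw [h]
  rw [Finset.sum_const, Int.card_Ico, nsmul_eq_mul]
  have : (((n : ℤ) - -(n : ℤ)).toNat : ℝ) = 2 * n := by
    have : ((n : ℤ) - -(n : ℤ)).toNat = 2 * n := by omega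
    rw [this]
    push_cast
    ring
  rw [this]
  field_simp

/-- The `m`-th joint eigenvalues of the (twisted) circulant parts. -/
def jointEigenvalues (θ : ℝ) {k : ℕ} (n m : ℕ) (ω : Fin k → ℤ → ℂ) : Fin k → ℂ :=
  fun j => circulantEigenvalue θ n m (ω j)

theorem measurable_jointEigenvalues (θ : ℝ) {k : ℕ} (n m : ℕ) :
    Measurable (jointEigenvalues θ (k := k) n m) :=
  measurable_pi_lambda _ fun j => (measurable_circulantEigenvalue θ n m).comp (measurable_pi_apply j)

theorem map_jointEigenvalues (θ : ℝ) {k n : ℕ} (hn : 1 ≤ n) (m : ℕ) :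
    (gaussianArray k).map (jointEigenvalues θ n m) = Measure.pi fun _ => stdComplexGaussian := by
  have h := Measure.infinitePi_map_pi
    (μ := fun _ : Fin k => Measure.infinitePi fun _ : ℤ => stdComplexGaussian)
    (f := fun _ => circulantEigenvalue θ n m) fun _ => measurable_circulantEigenvalue θ n m
  simp_rw [map_circulantEigenvalue θ hn] at h
  rw [← Measure.infinitePi_eq_pi]
  exact h

/-- The algebra of sequences of random matrices of growing size. -/
abbrev MatrixSeq (k : ℕ) : Type :=
  ∀ n : ℕ, (Fin k → ℤ → ℂ) → Matrix (Fin n) (Fin n) ℂ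

/-- The functional calculus of the (twisted) circulant parts. -/
def circulantCalculus (θ : ℝ) (k : ℕ) : ((Fin k → ℂ) → ℂ) →⋆ₐ[ℂ] MatrixSeq k where
  toFun h n ω := fourierMatrix θ n *
    Matrix.diagonal (fun m : Fin n => h (jointEigenvalues θ n m ω)) * star (fourierMatrix θ n)
  map_one' := by
    funext n ω
    simp only [Pi.one_apply, Matrix.diagonal_one, mul_one, fourierMatrix_mul_star]
  map_mul' h h' := by
    funext n ω
    simp only [Pi.mul_apply]
    rw [← Matrix.diagonal_mul_diagonal]
    simp only [← mul_assoc]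
    rw [mul_assoc _ (star (fourierMatrix θ n)) (fourierMatrix θ n), star_mul_fourierMatrix,
      mul_one]
  map_zero' := by
    funext n ω
    simp
  map_add' h h' := by
    funext n ω
    simp only [Pi.add_apply]
    rw [← Matrix.diagonal_add, mul_add, add_mul]
  commutes' c := by
    funext n ω
    have : (Matrix.diagonal fun _ : Fin n => c) = c • (1 : Matrix (Fin n) (Fin n) ℂ) := by
      rw [Matrix.smul_one_eq_diagonal]
    simp only [Pi.algebraMap_apply, Algebra.algebraMap_self, RingHom.id_apply, this, mul_smul_comm,
      mul_one, smul_mul_assoc, fourierMatrix_mul_star, Algebra.algebraMap_eq_smul_one]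
  map_star' h := by
    funext n ω
    simp only [Pi.star_apply, star_mul, star_star, mul_assoc]
    congr 2
    exact (Matrix.diagonal_conjTranspose _).symm

/-- By unitary invariance the trace is the sum of `h` over the `n` joint eigenvalue tuples. All
tuples have the same law, and linearity makes their mutual dependence irrelevant. -/
theorem expectedTrace_circulantCalculus (θ : ℝ) {k n : ℕ} (hn : 1 ≤ n) {h : (Fin k → ℂ) → ℂ}
    (hh : Integrable h (Measure.pi fun _ => stdComplexGaussian)) :
    expectedTrace (gaussianArray k) n (circulantCalculus θ k h n) =
      ∫ z, h z ∂Measure.pi fun _ => stdComplexGaussian := by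
  have hn0 : (n : ℂ) ≠ 0 := by exact_mod_cast (by omega : n ≠ 0)
  have h1 : ∀ ω, (circulantCalculus θ k h n ω).trace =
      ∑ m : Fin n, h (jointEigenvalues θ n m ω) := by
    intro ω
    change (fourierMatrix θ n * _ * star (fourierMatrix θ n)).trace = _
    rw [Matrix.trace_mul_cycle, star_mul_fourierMatrix, one_mul, Matrix.trace_diagonal]
  have h2 : ∀ m : Fin n, ∫ ω, h (jointEigenvalues θ n m ω) ∂gaussianArray k =
      ∫ z, h z ∂Measure.pi fun _ => stdComplexGaussian := by
    intro m
    rw [← map_jointEigenvalues θ hn m, integral_map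
      (measurable_jointEigenvalues θ n m).aemeasurable]
    rw [map_jointEigenvalues θ hn m]
    exact hh.aestronglyMeasurable
  rw [expectedTrace]
  simp_rw [h1]
  rw [integral_finsetSum]
  · simp_rw [h2]
    rw [Finset.sum_const, Finset.card_univ, Fintype.card_fin, nsmul_eq_mul,
      inv_mul_cancel_left₀ hn0]
  · intro m _
    rw [← map_jointEigenvalues θ hn m] at hh
    exact hh.comp_measurable (measurable_jointEigenvalues θ n m)

/-- Summing over the eigenvalue index keeps only the variables whose index is congruent to `i' - i`
modulo `n`. -/
theorem circulantCalculus_eval_apply (θ : ℝ) {k n : ℕ} (j : Fin k) (ω : Fin k → ℤ → ℂ)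
    (i i' : Fin n) :
    circulantCalculus θ k (fun z => z j) n ω i i' =
      ((Real.sqrt 2 : ℝ) : ℂ)⁻¹ * ((Real.sqrt n : ℝ) : ℂ)⁻¹ * ∑ x ∈ Finset.Ico (-(n : ℤ)) n,
        if (n : ℤ) ∣ x - (((i' : ℕ) : ℤ) - ((i : ℕ) : ℤ)) then
          phase θ n 0 (x - (((i' : ℕ) : ℤ) - ((i : ℕ) : ℤ))) * ω j x else 0 := by
  have hn : 1 ≤ n := i.pos
  have hn0 : (n : ℂ) ≠ 0 := by exact_mod_cast (by omega : n ≠ 0)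
  change (fourierMatrix θ n * Matrix.diagonal (fun m : Fin n => circulantEigenvalue θ n m (ω j)) *
    star (fourierMatrix θ n)) i i' = _
  rw [fourierMatrix_mul_diagonal_mul_apply]
  simp_rw [circulantEigenvalue, Finset.mul_sum]
  rw [Finset.sum_comm]
  refine Finset.sum_congr rfl fun x _ => ?_
  have h : ∀ m : Fin n, (n : ℂ)⁻¹ * (phase θ n m (((i : ℕ) : ℤ) - ((i' : ℕ) : ℤ)) *
      (((Real.sqrt 2 : ℝ) : ℂ)⁻¹ * ((Real.sqrt n : ℝ) : ℂ)⁻¹ * phase θ n m x * ω j x)) =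
      ((n : ℂ)⁻¹ * ((Real.sqrt 2 : ℝ) : ℂ)⁻¹ * ((Real.sqrt n : ℝ) : ℂ)⁻¹ * ω j x) *
        phase θ n m (x - (((i' : ℕ) : ℤ) - ((i : ℕ) : ℤ))) := by
    intro m
    rw [show x - (((i' : ℕ) : ℤ) - ((i : ℕ) : ℤ)) = (((i : ℕ) : ℤ) - ((i' : ℕ) : ℤ)) + x by ring,
      phase_add]
    ring
  simp_rw [h]
  rw [← Finset.mul_sum, sum_phase θ hn]
  split_ifs
  · field_simp
  · simp

/-! ### The limiting `*`-probability space -/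

section ModelAlgebra

variable {k : ℕ}

theorem expectedTrace_add {n : ℕ} {Ω : Type*} [MeasurableSpace Ω] {P : Measure Ω}
    {a b : Ω → Matrix (Fin n) (Fin n) ℂ} (ha : Integrable (fun ω => (a ω).trace) P)
    (hb : Integrable (fun ω => (b ω).trace) P) :
    expectedTrace P n (a + b) = expectedTrace P n a + expectedTrace P n b := by
  simp only [expectedTrace, Pi.add_apply, Matrix.trace_add]
  rw [integral_add ha hb, mul_add]

theorem expectedTrace_smul {n : ℕ} {Ω : Type*} [MeasurableSpace Ω] {P : Measure Ω}
    (c : ℂ) (a : Ω → Matrix (Fin n) (Fin n) ℂ) :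
    expectedTrace P n (c • a) = c * expectedTrace P n a := by
  simp only [expectedTrace, Pi.smul_apply, Matrix.trace_smul, smul_eq_mul]
  rw [integral_const_mul, mul_left_comm]

/-- The sequences of random matrices with bounded expected normalized traces. -/
def boundedTraceSeq (k : ℕ) : Submodule ℂ (MatrixSeq k) where
  carrier := {a | (∀ n, Integrable (fun ω => (a n ω).trace) (gaussianArray k)) ∧
    ∃ K : ℝ, ∀ n, ‖expectedTrace (gaussianArray k) n (a n)‖ ≤ K}
  zero_mem' := ⟨fun n => by simp, 0, fun n => by simp [expectedTrace]⟩
  add_mem' := by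
    rintro a b ⟨ha, Ka, hKa⟩ ⟨hb, Kb, hKb⟩
    refine ⟨fun n => ?_, Ka + Kb, fun n => ?_⟩
    · simp only [Pi.add_apply, Matrix.trace_add]
      exact (ha n).add (hb n)
    · rw [Pi.add_apply, expectedTrace_add (ha n) (hb n)]
      exact norm_add_le_of_le (hKa n) (hKb n)
  smul_mem' := by
    rintro c a ⟨ha, Ka, hKa⟩
    refine ⟨fun n => ?_, ‖c‖ * Ka, fun n => ?_⟩
    · simp only [Pi.smul_apply, Matrix.trace_smul, smul_eq_mul]
      exact (ha n).const_mul c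
    · rw [Pi.smul_apply, expectedTrace_smul, norm_mul]
      exact mul_le_mul_of_nonneg_left (hKa n) (norm_nonneg c)

/-- The sequences of Toeplitz matrices in a single family of variables with bounded weights and
shifted indices, and their adjoints. -/
def weightedToeplitzSeq (k : ℕ) : Set (MatrixSeq k) :=
  {a | ∃ (j : Fin k) (b : Bool) (c : ℕ → ℤ) (g : ∀ n, Fin n → Fin n → ℂ),
    (∀ n i i', ‖g n i i'‖ ≤ 1) ∧ ∀ n, IsWeightedToeplitz
      (fun (l : Fin k × ℤ) (ω : Fin k → ℤ → ℂ) => ω l.1 l.2) j b (c n) (g n) (a n)}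

theorem IsWeightedToeplitz.star {Ω ι : Type*} {n : ℕ} {X : ι × ℤ → Ω → ℂ} {j : ι} {b : Bool}
    {c : ℤ} {g : Fin n → Fin n → ℂ} {M : Ω → Matrix (Fin n) (Fin n) ℂ}
    (h : IsWeightedToeplitz X j b c g M) :
    IsWeightedToeplitz X j (!b) c (fun i i' => Star.star (g i' i)) (Star.star M) := by
  intro ω i i'
  have h1 : letterSign (!b) * (((i' : ℕ) : ℤ) - ((i : ℕ) : ℤ)) =
      letterSign b * (((i : ℕ) : ℤ) - ((i' : ℕ) : ℤ)) := by
    cases b <;> simp [letterSign]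
  have h2 : ∀ z, Star.star (letterEval b z) = letterEval (!b) z := by
    intro z
    cases b <;> simp [letterEval]
  rw [Pi.star_apply, Matrix.star_apply, h ω i' i, star_mul', star_mul', h1, h2,
    Complex.star_def, map_inv₀, Complex.conj_ofReal]

theorem star_mem_weightedToeplitzSeq {a : MatrixSeq k} (ha : a ∈ weightedToeplitzSeq k) :
    star a ∈ weightedToeplitzSeq k := by
  obtain ⟨j, b, c, g, hg, h⟩ := ha
  exact ⟨j, !b, c, fun n i i' => star (g n i' i), fun n i i' => by rw [norm_star]; exact hg _ _ _,
    fun n => (h n).star⟩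

/-- The `*`-algebra of sequences of random matrices generated by the weighted Toeplitz ones. -/
def toeplitzAlgebra (k : ℕ) : StarSubalgebra ℂ (MatrixSeq k) :=
  StarAlgebra.adjoin ℂ (weightedToeplitzSeq k)

theorem list_prod_mem_boundedTraceSeq (l : List (MatrixSeq k))
    (hl : ∀ a ∈ l, a ∈ weightedToeplitzSeq k) : l.prod ∈ boundedTraceSeq k := by
  have h : ∀ r : Fin l.length, l.get r ∈ weightedToeplitzSeq k := fun r => hl _ (l.get_mem r)
  choose j b c g hg hM using h
  have hprod : ∀ n, l.prod n = (List.ofFn fun r => l.get r n).prod := by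
    intro n
    have := map_list_prod (Pi.evalMonoidHom
      (fun n : ℕ => (Fin k → ℤ → ℂ) → Matrix (Fin n) (Fin n) ℂ) n) (List.ofFn l.get)
    rw [List.map_ofFn, List.ofFn_get] at this
    exact this
  obtain ⟨K, hK⟩ := exists_bound_expectedTrace_weightedToeplitz
    (isStandardizedInput_gaussianArray k) l.length
  refine ⟨fun n => ?_, K, fun n => ?_⟩
  · rw [hprod]
    exact integrable_trace_weightedToeplitz (isStandardizedInput_gaussianArray k)
      fun r => hM r n
  · rw [hprod]
    exact hK n j b (fun r => c r n) (fun r => g r n) _ (fun r => hg r n) fun r => hM r n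

/-- The generating set is closed under adjoints, so the algebra is the linear span of products of
generators, and bounded traces form a subspace. -/
theorem toeplitzAlgebra_le_boundedTraceSeq {a : MatrixSeq k} (ha : a ∈ toeplitzAlgebra k) :
    a ∈ boundedTraceSeq k := by
  have hstar : weightedToeplitzSeq k ∪ star (weightedToeplitzSeq k) = weightedToeplitzSeq k := by
    refine Set.union_eq_self_of_subset_right fun a ha => ?_
    rw [← star_star a]
    exact star_mem_weightedToeplitzSeq ha
  have h1 : a ∈ (toeplitzAlgebra k).toSubalgebra := ha
  rw [toeplitzAlgebra, StarAlgebra.adjoin_toSubalgebra, hstar, ← Subalgebra.mem_toSubmodule,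
    Algebra.adjoin_eq_span] at h1
  refine Submodule.span_le.2 ?_ h1
  intro b hb
  obtain ⟨l, hl, rfl⟩ := Submonoid.exists_list_of_mem_closure hb
  exact list_prod_mem_boundedTraceSeq l hl

/-- The traces stay in a closed disc, which is compact, so they converge along any ultrafilter; no
convergence of mixed moments has to be proved. -/
theorem exists_tendsto_expectedTrace (a : toeplitzAlgebra k) :
    ∃ z : ℂ, Tendsto (fun n => expectedTrace (gaussianArray k) n (a.1 n)) (hyperfilter ℕ)
      (𝓝 z) := by
  obtain ⟨-, K, hK⟩ := toeplitzAlgebra_le_boundedTraceSeq a.2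
  obtain ⟨z, -, hz⟩ := (isCompact_closedBall (0 : ℂ) K).ultrafilter_le_nhds
    ((hyperfilter ℕ).map fun n => expectedTrace (gaussianArray k) n (a.1 n)) (by
      rw [le_principal_iff]
      exact Filter.mem_map.2 (Filter.univ_mem' fun n => mem_closedBall_zero_iff.2 (hK n)))
  exact ⟨z, hz⟩

/-- The limit of the expected normalized traces along an ultrafilter. -/
def limitState (k : ℕ) : toeplitzAlgebra k →ₗ[ℂ] ℂ where
  toFun a := (exists_tendsto_expectedTrace a).choose
  map_add' a b := by
    refine tendsto_nhds_unique (exists_tendsto_expectedTrace (a + b)).choose_spec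
      (((exists_tendsto_expectedTrace a).choose_spec.add
        (exists_tendsto_expectedTrace b).choose_spec).congr fun n => ?_)
    exact (expectedTrace_add ((toeplitzAlgebra_le_boundedTraceSeq a.2).1 n)
      ((toeplitzAlgebra_le_boundedTraceSeq b.2).1 n)).symm
  map_smul' c a := by
    refine tendsto_nhds_unique (exists_tendsto_expectedTrace (c • a)).choose_spec
      (((exists_tendsto_expectedTrace a).choose_spec.const_mul c).congr fun n => ?_)
    exact (expectedTrace_smul c (a.1 n)).symm

theorem tendsto_limitState (a : toeplitzAlgebra k) :
    Tendsto (fun n => expectedTrace (gaussianArray k) n (a.1 n)) (hyperfilter ℕ)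
      (𝓝 (limitState k a)) := (exists_tendsto_expectedTrace a).choose_spec

theorem limitState_eq_of_tendsto {a : toeplitzAlgebra k} {z : ℂ}
    (h : Tendsto (fun n => expectedTrace (gaussianArray k) n (a.1 n)) atTop (𝓝 z)) :
    limitState k a = z :=
  tendsto_nhds_unique (tendsto_limitState a) (h.mono_left Nat.hyperfilter_le_atTop)

theorem limitState_eq_of_forall {a : toeplitzAlgebra k} {z : ℂ}
    (h : ∀ n, 1 ≤ n → expectedTrace (gaussianArray k) n (a.1 n) = z) :
    limitState k a = z := by
  refine limitState_eq_of_tendsto (tendsto_const_nhds.congr' ?_)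
  filter_upwards [eventually_ge_atTop 1] with n hn
  exact (h n hn).symm

/-! ### Positivity of the limit state -/

theorem trace_star_mul_self {n : ℕ} (M : Matrix (Fin n) (Fin n) ℂ) :
    (star M * M).trace = ((∑ i, ∑ j, ‖M j i‖ ^ 2 : ℝ) : ℂ) := by
  simp only [Matrix.trace, Matrix.diag_apply, Matrix.mul_apply, Matrix.star_apply]
  push_cast
  refine Finset.sum_congr rfl fun i _ => Finset.sum_congr rfl fun j _ => ?_
  rw [Complex.star_def, Complex.conj_mul']

theorem exists_expectedTrace_star_mul_self {n : ℕ} {Ω : Type*} [MeasurableSpace Ω]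
    {P : Measure Ω} (a : Ω → Matrix (Fin n) (Fin n) ℂ) :
    ∃ x : ℝ, 0 ≤ x ∧ expectedTrace P n (star a * a) = x := by
  refine ⟨(n : ℝ)⁻¹ * ∫ ω, ∑ i, ∑ j, ‖a ω j i‖ ^ 2 ∂P,
    mul_nonneg (by positivity) (integral_nonneg fun ω => ?_), ?_⟩
  · positivity
  · simp only [expectedTrace, Pi.mul_apply, Pi.star_apply, trace_star_mul_self]
    rw [integral_complex_ofReal]
    push_cast
    rfl

theorem isState_limitState (k : ℕ) : IsState (limitState k) where
  map_one := by
    refine limitState_eq_of_forall fun n hn => ?_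
    have hn0 : (n : ℂ) ≠ 0 := by exact_mod_cast (by omega : n ≠ 0)
    change (n : ℂ)⁻¹ * ∫ _, (1 : Matrix (Fin n) (Fin n) ℂ).trace ∂gaussianArray k = 1
    simp [hn0]
  nonneg_re a := by
    refine ge_of_tendsto (Complex.continuous_re.continuousAt.tendsto.comp
      (tendsto_limitState (star a * a))) (Eventually.of_forall fun n => ?_)
    obtain ⟨x, hx, h⟩ := exists_expectedTrace_star_mul_self (P := gaussianArray k) (a.1 n)
    change 0 ≤ (expectedTrace (gaussianArray k) n (star (a.1 n) * a.1 n)).re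
    rw [h]
    exact hx
  im_eq_zero a := by
    refine tendsto_nhds_unique (Complex.continuous_im.continuousAt.tendsto.comp
      (tendsto_limitState (star a * a))) (tendsto_const_nhds.congr fun n => ?_)
    obtain ⟨x, hx, h⟩ := exists_expectedTrace_star_mul_self (P := gaussianArray k) (a.1 n)
    change 0 = (expectedTrace (gaussianArray k) n (star (a.1 n) * a.1 n)).im
    rw [h]
    exact (Complex.ofReal_im x).symm

/-! ### Toeplitz matrices as sums of twisted circulants -/

/-- Since `|i' - i| < n` and `-n ≤ x < n`, a difference `x - (i' - i) = c n` lies strictly between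
`-2n` and `2n`, so `|c| ≤ 1`. -/
theorem sum_Ico_dvd_eq_sum_shifts {n : ℕ} (i i' : Fin n) (F : ℤ → ℂ → ℂ) (t : ℤ → ℂ) :
    (∑ x ∈ Finset.Ico (-(n : ℤ)) n, if (n : ℤ) ∣ x - (((i' : ℕ) : ℤ) - ((i : ℕ) : ℤ)) then
        F (x - (((i' : ℕ) : ℤ) - ((i : ℕ) : ℤ))) (t x) else 0) =
      ∑ c ∈ Finset.Icc (-1 : ℤ) 1,
        if c * n + (((i' : ℕ) : ℤ) - ((i : ℕ) : ℤ)) ∈ Finset.Ico (-(n : ℤ)) n then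
          F (c * n) (t (c * n + (((i' : ℕ) : ℤ) - ((i : ℕ) : ℤ)))) else 0 := by
  have hn : (0 : ℤ) < n := by exact_mod_cast i.pos
  have h1 := i.2
  have h2 := i'.2
  rw [← Finset.sum_filter, ← Finset.sum_filter]
  symm
  refine Finset.sum_nbij (fun c => c * n + (((i' : ℕ) : ℤ) - ((i : ℕ) : ℤ))) ?_ ?_ ?_ ?_
  · intro c hc
    rw [Finset.mem_filter] at hc ⊢
    exact ⟨hc.2, by rw [add_sub_cancel_right]; exact dvd_mul_left _ _⟩
  · intro c _ c' _ h
    simp only [add_left_inj] at h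
    exact mul_right_cancel₀ hn.ne' h
  · intro x hx
    rw [Finset.mem_coe, Finset.mem_filter, Finset.mem_Ico] at hx
    obtain ⟨hx, c, hc⟩ := hx
    have hxc : c * n + (((i' : ℕ) : ℤ) - ((i : ℕ) : ℤ)) = x := by
      rw [mul_comm, ← hc]; ring
    refine ⟨c, ?_, hxc⟩
    rw [Finset.mem_coe, Finset.mem_filter, hxc, Finset.mem_Icc, Finset.mem_Ico]
    refine ⟨⟨?_, ?_⟩, hx⟩
    · by_contra! hlt
      nlinarith
    · by_contra! hlt
      nlinarith
  · intro c _
    simp only [add_sub_cancel_right]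

/-- A twisted circulant is a combination of three Toeplitz matrices with indices shifted by `-n`,
`0`, `n` and weights that are phases or zero. This is why `weightedToeplitzSeq` allows weights and
shifts. -/
theorem circulantCalculus_eval_mem (θ : ℝ) (j : Fin k) :
    circulantCalculus θ k (fun z => z j) ∈ toeplitzAlgebra k := by
  let g : ℤ → ∀ n : ℕ, Fin n → Fin n → ℂ := fun c n i i' =>
    if c * n + (((i' : ℕ) : ℤ) - ((i : ℕ) : ℤ)) ∈ Finset.Ico (-(n : ℤ)) n then
      phase θ n 0 (c * n) else 0
  let G : ℤ → MatrixSeq k := fun c n ω => Matrix.of fun i i' =>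
    ((Real.sqrt n : ℝ) : ℂ)⁻¹ * g c n i i' * ω j (c * n + (((i' : ℕ) : ℤ) - ((i : ℕ) : ℤ)))
  have hG : ∀ c, G c ∈ toeplitzAlgebra k := by
    intro c
    refine StarAlgebra.subset_adjoin ℂ _ ⟨j, false, fun n => c * n, g c, fun n i i' => ?_,
      fun n ω i i' => ?_⟩
    · simp only [g]
      split_ifs
      · rw [norm_phase]
      · simp
    · simp [G, letterEval, letterSign]
  have h : circulantCalculus θ k (fun z => z j) =
      ((Real.sqrt 2 : ℝ) : ℂ)⁻¹ • ∑ c ∈ Finset.Icc (-1 : ℤ) 1, G c := by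
    funext n ω
    ext i i'
    rw [circulantCalculus_eval_apply, sum_Ico_dvd_eq_sum_shifts i i'
      (fun x z => phase θ n 0 x * z) (ω j)]
    simp only [Pi.smul_apply, Finset.sum_apply, Matrix.smul_apply, Matrix.sum_apply, smul_eq_mul,
      G, Matrix.of_apply, g]
    rw [mul_assoc, Finset.mul_sum]
    congr 1
    refine Finset.sum_congr rfl fun c _ => ?_
    split_ifs
    · ring
    · simp
  rw [h]
  exact (toeplitzAlgebra k).smul_mem (sum_mem fun c _ => hG c) _

/-- The (twisted) circulant parts of the Toeplitz matrices. -/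
def circulantPart (θ : ℝ) (j : Fin k) : toeplitzAlgebra k :=
  ⟨circulantCalculus θ k fun z => z j, circulantCalculus_eval_mem θ j⟩

/-- The wrapped terms `c = ±1` have phase `1` for the twist `0` and `-1` for the twist `1/2`, so
they cancel. The term `c = 0` is doubled, which offsets the two factors `1/√2`. -/
theorem circulantPart_add_circulantPart_half (j : Fin k) (n : ℕ) :
    (((Real.sqrt 2 : ℝ) : ℂ)⁻¹ • (circulantPart 0 j + circulantPart (1 / 2) j)).1 n =
      scaledToeplitz (fun x (ω : Fin k → ℤ → ℂ) => ω j x) n := by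
  funext ω
  ext i i'
  have hn : (n : ℂ) ≠ 0 := by exact_mod_cast i.pos.ne'
  have h1 := i.2
  have h2 := i'.2
  have hsqrt : ((Real.sqrt 2 : ℝ) : ℂ)⁻¹ * ((Real.sqrt 2 : ℝ) : ℂ)⁻¹ * 2 = 1 := by
    have := inv_sqrt_mul_inv_sqrt 2
    rw [Nat.cast_ofNat, Nat.cast_ofNat] at this
    rw [this]
    norm_num
  change ((Real.sqrt 2 : ℝ) : ℂ)⁻¹ * (circulantCalculus 0 k (fun z => z j) n ω i i' +
    circulantCalculus (1 / 2) k (fun z => z j) n ω i i') =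
    ((Real.sqrt n : ℝ) : ℂ)⁻¹ * ω j (((i' : ℕ) : ℤ) - ((i : ℕ) : ℤ))
  rw [circulantCalculus_eval_apply, circulantCalculus_eval_apply, ← mul_add,
    ← Finset.sum_add_distrib]
  have hsum : ∀ x : ℤ, (if (n : ℤ) ∣ x - (((i' : ℕ) : ℤ) - ((i : ℕ) : ℤ)) then
        phase 0 n 0 (x - (((i' : ℕ) : ℤ) - ((i : ℕ) : ℤ))) * ω j x else 0) +
      (if (n : ℤ) ∣ x - (((i' : ℕ) : ℤ) - ((i : ℕ) : ℤ)) then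
        phase (1 / 2) n 0 (x - (((i' : ℕ) : ℤ) - ((i : ℕ) : ℤ))) * ω j x else 0) =
      if (n : ℤ) ∣ x - (((i' : ℕ) : ℤ) - ((i : ℕ) : ℤ)) then
        (1 + phase (1 / 2) n 0 (x - (((i' : ℕ) : ℤ) - ((i : ℕ) : ℤ)))) * ω j x else 0 := by
    intro x
    have : phase 0 n 0 (x - (((i' : ℕ) : ℤ) - ((i : ℕ) : ℤ))) = 1 := by simp [phase]
    rw [this]
    split_ifs <;> ring
  have hphase : ∀ c : ℤ, phase (1 / 2) n 0 (c * n) = Complex.exp (c * (Real.pi * Complex.I)) := by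
    intro c
    rw [phase]
    congr 1
    push_cast
    field_simp
    ring
  simp_rw [hsum]
  rw [sum_Ico_dvd_eq_sum_shifts i i' (fun x z => (1 + phase (1 / 2) n 0 x) * z) (ω j),
    Finset.sum_eq_single_of_mem 0 (by simp)]
  · rw [if_pos (by rw [Finset.mem_Ico]; omega), hphase]
    simp only [Int.cast_zero, zero_mul, Complex.exp_zero, zero_add]
    linear_combination (((Real.sqrt n : ℝ) : ℂ)⁻¹ * ω j (((i' : ℕ) : ℤ) - ((i : ℕ) : ℤ))) * hsqrt
  · intro c hc hc0
    have hz : 1 + phase (1 / 2) n 0 (c * n) = 0 := by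
      rw [Finset.mem_Icc] at hc
      rw [hphase]
      have : c = 1 ∨ c = -1 := by omega
      rcases this with rfl | rfl
      · simp [Complex.exp_pi_mul_I]
      · simp [Complex.exp_neg, Complex.exp_pi_mul_I]
    rw [hz]
    simp

/-! ### Law and independence of the circulant parts -/

theorem limitState_circulantCalculus (θ : ℝ) {h : (Fin k → ℂ) → ℂ}
    (hh : Integrable h (Measure.pi fun _ => stdComplexGaussian)) {a : toeplitzAlgebra k}
    (ha : a.1 = circulantCalculus θ k h) :
    limitState k a = ∫ z, h z ∂Measure.pi fun _ => stdComplexGaussian := by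
  refine limitState_eq_of_forall fun n hn => ?_
  rw [ha, expectedTrace_circulantCalculus θ hn hh]

/-- Continuous functions of polynomial growth. -/
def HasPolynomialGrowth (h : ℂ → ℂ) : Prop :=
  Continuous h ∧ ∃ (C : ℝ) (q : ℕ), ∀ z, ‖h z‖ ≤ C * (1 + ‖z‖) ^ q

theorem HasPolynomialGrowth.exists_nonneg {h : ℂ → ℂ} (hh : HasPolynomialGrowth h) :
    ∃ (C : ℝ) (q : ℕ), 0 ≤ C ∧ ∀ z, ‖h z‖ ≤ C * (1 + ‖z‖) ^ q := by
  obtain ⟨-, C, q, h⟩ := hh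
  refine ⟨C, q, ?_, h⟩
  have := (norm_nonneg _).trans (h 0)
  simpa using this

theorem hasPolynomialGrowth_id : HasPolynomialGrowth fun z => z :=
  ⟨continuous_id, 1, 1, fun z => by simp⟩

theorem hasPolynomialGrowth_const (c : ℂ) : HasPolynomialGrowth fun _ => c :=
  ⟨continuous_const, ‖c‖, 0, fun z => by simp⟩

theorem HasPolynomialGrowth.mul {h h' : ℂ → ℂ} (hh : HasPolynomialGrowth h)
    (hh' : HasPolynomialGrowth h') : HasPolynomialGrowth fun z => h z * h' z := by
  obtain ⟨C, q, hC, hq⟩ := hh.exists_nonneg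
  obtain ⟨C', q', -, hq'⟩ := hh'.exists_nonneg
  refine ⟨hh.1.mul hh'.1, C * C', q + q', fun z => ?_⟩
  rw [norm_mul, pow_add, mul_mul_mul_comm]
  exact mul_le_mul (hq z) (hq' z) (norm_nonneg _) (by positivity)

theorem HasPolynomialGrowth.add {h h' : ℂ → ℂ} (hh : HasPolynomialGrowth h)
    (hh' : HasPolynomialGrowth h') : HasPolynomialGrowth fun z => h z + h' z := by
  obtain ⟨C, q, hC, hq⟩ := hh.exists_nonneg
  obtain ⟨C', q', hC', hq'⟩ := hh'.exists_nonneg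
  refine ⟨hh.1.add hh'.1, C + C', q + q', fun z => ?_⟩
  have h1 : (1 : ℝ) ≤ 1 + ‖z‖ := by linarith [norm_nonneg z]
  calc ‖h z + h' z‖ ≤ C * (1 + ‖z‖) ^ q + C' * (1 + ‖z‖) ^ q' := norm_add_le_of_le (hq z) (hq' z)
    _ ≤ C * (1 + ‖z‖) ^ (q + q') + C' * (1 + ‖z‖) ^ (q + q') :=
        add_le_add (mul_le_mul_of_nonneg_left (pow_le_pow_right₀ h1 (by omega)) hC)
          (mul_le_mul_of_nonneg_left (pow_le_pow_right₀ h1 (by omega)) hC')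
    _ = _ := by ring

theorem HasPolynomialGrowth.star {h : ℂ → ℂ} (hh : HasPolynomialGrowth h) :
    HasPolynomialGrowth fun z => Star.star (h z) := by
  obtain ⟨C, q, h1⟩ := hh.2
  exact ⟨continuous_star.comp hh.1, C, q, fun z => by rw [norm_star]; exact h1 z⟩

theorem HasPolynomialGrowth.integrable {h : ℂ → ℂ} (hh : HasPolynomialGrowth h) :
    Integrable h stdComplexGaussian := by
  obtain ⟨C, q, h1⟩ := hh.2
  have h2 : Integrable (fun z : ℂ => C * (1 + ‖z‖) ^ q) stdComplexGaussian := by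
    simp_rw [add_comm (1 : ℝ), add_pow, one_pow, mul_one]
    exact (integrable_finsetSum _ fun i _ =>
      (integrable_norm_pow_stdComplexGaussian i).mul_const _).const_mul C
  exact h2.mono' hh.1.aestronglyMeasurable (ae_of_all _ h1)

theorem HasPolynomialGrowth.pow {h : ℂ → ℂ} (hh : HasPolynomialGrowth h) (p : ℕ) :
    HasPolynomialGrowth fun z => h z ^ p := by
  induction p with
  | zero => simpa using hasPolynomialGrowth_const 1
  | succ p ih => simpa only [pow_succ] using ih.mul hh

/-- Elements of the generated `*`-algebra are functions of the `j`-th eigenvalue alone; the growth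
condition is stable under the operations and provides integrability. -/
theorem exists_circulantCalculus_of_mem_adjoin (θ : ℝ) (j : Fin k) {x : toeplitzAlgebra k}
    (hx : x ∈ StarAlgebra.adjoin ℂ {circulantPart θ j}) :
    ∃ h : ℂ → ℂ, HasPolynomialGrowth h ∧ x.1 = circulantCalculus θ k fun z => h (z j) := by
  induction hx using StarAlgebra.adjoin_induction with
  | mem x hx =>
    rw [Set.mem_singleton_iff] at hx
    subst hx
    exact ⟨_, hasPolynomialGrowth_id, rfl⟩
  | algebraMap c =>
    refine ⟨_, hasPolynomialGrowth_const c, ?_⟩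
    exact (AlgHomClass.commutes (circulantCalculus θ k) c).symm
  | add x y _ _ hx hy =>
    obtain ⟨h, hh, hx⟩ := hx
    obtain ⟨h', hh', hy⟩ := hy
    refine ⟨_, hh.add hh', ?_⟩
    change x.1 + y.1 = _
    rw [hx, hy, ← map_add]
    rfl
  | mul x y _ _ hx hy =>
    obtain ⟨h, hh, hx⟩ := hx
    obtain ⟨h', hh', hy⟩ := hy
    refine ⟨_, hh.mul hh', ?_⟩
    change x.1 * y.1 = _
    rw [hx, hy, ← map_mul]
    rfl
  | star x _ hx =>
    obtain ⟨h, hh, hx⟩ := hx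
    refine ⟨_, hh.star, ?_⟩
    change star x.1 = _
    rw [hx, ← map_star]
    rfl

theorem HasPolynomialGrowth.integrable_comp_eval {h : ℂ → ℂ} (hh : HasPolynomialGrowth h)
    (j : Fin k) : Integrable (fun z : Fin k → ℂ => h (z j))
      (Measure.pi fun _ => stdComplexGaussian) :=
  (measurePreserving_eval (fun _ : Fin k => stdComplexGaussian) j).integrable_comp_of_integrable
    hh.integrable

theorem HasPolynomialGrowth.integral_comp_eval {h : ℂ → ℂ} (hh : HasPolynomialGrowth h)
    (j : Fin k) : ∫ z : Fin k → ℂ, h (z j) ∂Measure.pi (fun _ => stdComplexGaussian) =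
      ∫ z, h z ∂stdComplexGaussian := by
  have hp := measurePreserving_eval (fun _ : Fin k => stdComplexGaussian) j
  conv_rhs => rw [← hp.map_eq]
  exact (integral_map hp.measurable.aemeasurable hh.1.aestronglyMeasurable).symm

theorem isStdComplexGaussianVar_circulantPart (θ : ℝ) (j : Fin k) :
    IsStdComplexGaussianVar (limitState k) (circulantPart θ j) where
  normal := by
    refine Subtype.ext ?_
    change star (circulantCalculus θ k fun z => z j) * (circulantCalculus θ k fun z => z j) =
      (circulantCalculus θ k fun z => z j) * star (circulantCalculus θ k fun z => z j)
    rw [← map_star, ← map_mul, ← map_mul, mul_comm]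
  moment p q := by
    have hh := (hasPolynomialGrowth_id.pow p).mul (hasPolynomialGrowth_id.star.pow q)
    refine (limitState_circulantCalculus θ (hh.integrable_comp_eval j) ?_).trans
      (hh.integral_comp_eval j)
    · change (circulantCalculus θ k fun z => z j) ^ p *
        star (circulantCalculus θ k fun z => z j) ^ q = _
      rw [← map_star, ← map_pow, ← map_pow, ← map_mul]
      rfl

/-- For a fixed twist everything is the image of commuting functions under a `*`-homomorphism, and
the factorization is Fubini for the product Gaussian measure. -/
theorem isIndepFamily_circulantPart (θ : ℝ) (k : ℕ) :
    IsIndepFamily (limitState k) (circulantPart θ (k := k)) where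
  commute i j _ x hx y hy := by
    obtain ⟨h, -, hx⟩ := exists_circulantCalculus_of_mem_adjoin θ i hx
    obtain ⟨h', -, hy⟩ := exists_circulantCalculus_of_mem_adjoin θ j hy
    refine Subtype.ext ?_
    change x.1 * y.1 = y.1 * x.1
    rw [hx, hy, ← map_mul, ← map_mul, mul_comm]
  factor x hx := by
    choose h hh hxh using fun i => exists_circulantCalculus_of_mem_adjoin θ i (hx i)
    have hprod : (List.ofFn x).prod.1 = circulantCalculus θ k fun z => ∏ i, h i (z i) := by
      have h1 := map_list_prod (toeplitzAlgebra k).subtype (List.ofFn x)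
      have h2 := map_list_prod (circulantCalculus θ k)
        (List.ofFn fun i => fun z : Fin k → ℂ => h i (z i))
      rw [List.map_ofFn] at h1 h2
      rw [List.prod_ofFn] at h2
      have h3 : (fun z : Fin k → ℂ => ∏ i, h i (z i)) =
          ∏ i, fun z : Fin k → ℂ => h i (z i) := by
        funext z
        rw [Finset.prod_apply]
      rw [h3, h2]
      refine h1.trans ?_
      congr 2
      funext i
      exact hxh i
    rw [limitState_circulantCalculus θ (Integrable.fintype_prod fun i => (hh i).integrable) hprod,
      integral_fintype_prod_eq_prod]
    refine Finset.prod_congr rfl fun i _ => ?_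
    rw [limitState_circulantCalculus θ ((hh i).integrable_comp_eval i) (hxh i),
      (hh i).integral_comp_eval]

/-- At each `n` the word is one in Gaussian Toeplitz matrices, whose expected trace converges in the
ordinary sense; the ultrafilter limit must be that universal value. -/
theorem limitState_starWord (w : List (Fin k × Bool)) :
    limitState k (starWord (fun j => ((Real.sqrt 2 : ℝ) : ℂ)⁻¹ •
      (circulantPart 0 j + circulantPart (1 / 2) j)) w) =
      toeplitzMoment (fun r => (w.get r).1) (fun r => (w.get r).2) := by
  refine limitState_eq_of_tendsto ((tendsto_expectedTrace_starWord
    (τ := fun j x (ω : Fin k → ℤ → ℂ) => ω j x)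
    (isStandardizedInput_gaussianArray k) w).congr fun n => ?_)
  congr 1
  have h := map_list_prod ((Pi.evalMonoidHom
    (fun n : ℕ => (Fin k → ℤ → ℂ) → Matrix (Fin n) (Fin n) ℂ) n).comp
    ((toeplitzAlgebra k).subtype : toeplitzAlgebra k →* MatrixSeq k))
    (w.map fun l => if l.2 then star (((Real.sqrt 2 : ℝ) : ℂ)⁻¹ •
      (circulantPart 0 l.1 + circulantPart (1 / 2) l.1)) else ((Real.sqrt 2 : ℝ) : ℂ)⁻¹ •
      (circulantPart 0 l.1 + circulantPart (1 / 2) l.1))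
  rw [List.map_map] at h
  refine Eq.trans ?_ h.symm
  rw [starWord]
  congr 2
  funext l
  rw [← circulantPart_add_circulantPart_half, Function.comp_apply]
  split_ifs <;> rfl

end ModelAlgebra

end

theorem theorem4p2 (k : ℕ) :
    ∃ (A : Type) (_ : Ring A) (_ : StarRing A) (_ : Algebra ℂ A) (_ : StarModule ℂ A)
      (φ : A →ₗ[ℂ] ℂ) (N N' : Fin k → A),
      IsState φ ∧
      (∀ j, IsStdComplexGaussianVar φ (N j)) ∧ IsIndepFamily φ N ∧
      (∀ j, IsStdComplexGaussianVar φ (N' j)) ∧ IsIndepFamily φ N' ∧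
      ∀ (Ω : Type u) [MeasurableSpace Ω] (P : Measure Ω) [IsProbabilityMeasure P]
        (τ : Fin k → ℤ → Ω → ℂ),
        IsStandardizedInput P (fun l : Fin k × ℤ => τ l.1 l.2) →
        (∀ (n : ℕ) (w : List (Fin k × Bool)),
          Integrable (fun ω => (starWord (fun j => scaledToeplitz (τ j) n) w ω).trace) P) ∧
        TendstoInStarDistribution
          (fun n => expectedTrace P n) (fun n j => scaledToeplitz (τ j) n)
          φ (fun j => ((Real.sqrt 2 : ℝ) : ℂ)⁻¹ • (N j + N' j)) := by
  refine ⟨toeplitzAlgebra k, inferInstance, inferInstance, inferInstance, inferInstance,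
    limitState k, circulantPart 0, circulantPart (1 / 2), isState_limitState k,
    isStdComplexGaussianVar_circulantPart 0, isIndepFamily_circulantPart 0 k,
    isStdComplexGaussianVar_circulantPart (1 / 2), isIndepFamily_circulantPart (1 / 2) k, ?_⟩
  intro Ω _ P _ τ hτ
  refine ⟨fun n w => integrable_trace_starWord_scaledToeplitz hτ n w, fun w => ?_⟩
  rw [limitState_starWord]
  exact tendsto_expectedTrace_starWord hτ w
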